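/- Let \(N\) agents be given. Agent \(i\) is modelled by a Markov decision process with finite state set \(\mathcal S^i\), initial state \(s_I^i\), finite action set \(\mathcal A^i\) and transition probabilities \(\mathcal T^i:\mathcal S^i\times\mathcal A^i\to\Delta(\mathcal S^i)\). Let \(\mathbf S=\prod_i\mathcal S^i\), \(\mathbf A=\prod_i\mathcal A^i\), \(\mathbf s_I=(s_I^i)_i\), and \(\mathbf T(\mathbf s,\mathbf a,\mathbf y)=\prod_i\mathcal T^i(s^i,a^i,y^i)\), and let \(\pi:\mathbf S\to\Delta(\mathbf A)\) be a stationary joint policy. Full communication: \(\mathbf s_0=\mathbf s_I\), \(\mathbf a_t\sim\pi(\mathbf s_t)\), \(\mathbf s_{t+1}\sim\mathbf T(\mathbf s_t,\mathbf a_t)\). Let \(\Gamma^{full}\) be the distribution of the infinite joint path \(\mathbf s_0\mathbf a_0\mathbf s_1\mathbf a_1\ldots\). Intermittent communication with availability sequence \(\Lambda=(\lambda_t)_{t\ge0}\in\{0,1\}^{\mathbb N}\): each agent \(i\) maintains a joint state \(\hat{\mathbf s}_{t,i}\), whose \(i\)-th component is its true state \(s^i_t\) and whose other components are (possibly imaginary)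 copies of the states of its teammates, and a joint action \(\hat{\mathbf a}_{t,i}\), of which it executes the \(i\)-th component \(a^i_t=\hat a^i_{t,i}\). The true states start at \(s^i_0=s_I^i\) and move by \(s^i_{t+1}\sim\mathcal T^i(s^i_t,a^i_t)\). If \(\lambda_t=1\), the agents share their true states and draw one common joint action: \(\hat{\mathbf s}_{t,i}=\mathbf s_t\) and \(\hat{\mathbf a}_{t,i}=\mathbf a_t\) for all \(i\), with \(\mathbf a_t\sim\pi(\mathbf s_t)\). If \(\lambda_t=0\), every agent \(i\) sets \(\hat s^j_{0,i}=s_I^j\) (if \(t=0\)) or samples \(\hat s^j_{t,i}\sim\mathcal T^j(\hat s^j_{t-1,i},\hat a^j_{t-1,i})\) (if \(t\ge1\)) for all \(j\ne i\), and then draws its own \(\hat{\mathbf a}_{t,i}\sim\pi(\hat{\mathbf s}_{t,i})\). All draws are independent given the past. Let \(\Gamma^{int}_\Lambda\) be the resulting distribution of the joint path \(\mathbf s_0\mathbf a_0\mathbf s_1\mathbf a_1\ldots\) of true states and executed actions. Let \(\Gamma^{img}_0\) be the distribution of the joint path under imaginary play with communication lost at time \(0\), i.e. when the agents follow the rule for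 \(\lambda_t=0\) at all times \(t\ge0\). For probability measures \(P,Q\), let \(KL(P\|Q)=\int\log\frac{dP}{dQ}\,dP\in[0,\infty]\), which is \(+\infty\) if \(P\not\ll Q\). (1) For every sequence \(\Lambda\in\{0,1\}^{\mathbb N}\), \[KL(\Gamma^{full}\|\Gamma^{int}_\Lambda)\le KL(\Gamma^{full}\|\Gamma^{img}_0).\] (2) Let \(q\in[0,1]\), let \(\Lambda=(\lambda_t)_{t\ge0}\) be a random sequence of independent Bernoulli variables with \(\Pr(\lambda_t=1)=1-q\), and let \(\Gamma^{int}=\mathbb E_\Lambda[\Gamma^{int}_\Lambda]\) be the corresponding mixture of path distributions. Then \[KL(\Gamma^{full}\|\Gamma^{int})\le q\,KL(\Gamma^{full}\|\Gamma^{img}_0),\] where \(0\cdot\infty=0\). -/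

import Mathlib

open MeasureTheory ProbabilityTheory
open scoped ENNReal

noncomputable section

namespace TeamComm

/-- The law of independent samples, one from each of the distributions `p i`. -/
def prodPMF {ι : Type*} [Fintype ι] [DecidableEq ι] {α : ι → Type*} [∀ i, Fintype (α i)]
    (p : ∀ i, PMF (α i)) : PMF (∀ i, α i) :=
  PMF.ofFintype (fun x => ∏ i, p i (x i)) (by
    rw [← Fintype.prod_sum fun i x => p i x]
    exact Finset.prod_eq_one fun i _ => (tsum_fintype (fun x => p i x)).symm.trans (p i).tsum_coe)

section Chain

variable {X : Type*} [Countable X] [MeasurableSpace X] [MeasurableSingletonClass X]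

/-- One step of a chain, as a kernel which depends on the past only through the present. -/
def stepKernel (step : ℕ → X → PMF X) (n : ℕ) :
    Kernel ((i : Finset.Iic n) → (fun _ : ℕ => X) i) ((fun _ : ℕ => X) (n + 1)) :=
  (Kernel.ofFunOfCountable fun x : X => (step n x).toMeasure).comap
    (fun h : (i : Finset.Iic n) → (fun _ : ℕ => X) i => (h ⟨n, Finset.mem_Iic.2 le_rfl⟩ : X))
    (measurable_pi_apply _)

instance (step : ℕ → X → PMF X) (n : ℕ) : IsMarkovKernel (stepKernel step n) := by
  have : IsMarkovKernel (Kernel.ofFunOfCountable fun x : X => (step n x).toMeasure) :=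
    ⟨fun x => PMF.toMeasure.isProbabilityMeasure (step n x)⟩
  unfold stepKernel
  infer_instance

/-- The law on infinite trajectories of the Markov chain with initial distribution `init`,
moving from time `n` to time `n + 1` according to `step n`. -/
def chainLaw (init : PMF X) (step : ℕ → X → PMF X) : Measure (ℕ → X) :=
  Kernel.trajMeasure (X := fun _ : ℕ => X) init.toMeasure (stepKernel step)

instance (init : PMF X) (step : ℕ → X → PMF X) :
    IsProbabilityMeasure (chainLaw init step) := by
  have : IsProbabilityMeasure init.toMeasure := PMF.toMeasure.isProbabilityMeasure init
  unfold chainLaw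
  infer_instance

/-- The law of the chain up to time `n` depends only on the first `n` steps. -/
theorem map_frestrictLe_chainLaw_congr (init : PMF X) {step step' : ℕ → X → PMF X} (n : ℕ)
    (h : ∀ k < n, step k = step' k) :
    (chainLaw init step).map (Preorder.frestrictLe (π := fun _ : ℕ => X) n) =
      (chainLaw init step').map (Preorder.frestrictLe (π := fun _ : ℕ => X) n) := by
  have key : ∀ m ≤ n, Kernel.partialTraj (X := fun _ : ℕ => X) (stepKernel step) 0 m =
      Kernel.partialTraj (X := fun _ : ℕ => X) (stepKernel step') 0 m := by
    intro m
    induction m with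
    | zero => intro _; simp only [Kernel.partialTraj_self]
    | succ m ih =>
      intro hm
      have hk : stepKernel step m = stepKernel step' m := by
        unfold stepKernel
        congr 2
        exact congrArg (fun f => fun x : X => (f x).toMeasure) (h m hm)
      rw [Kernel.partialTraj_succ_eq_comp (Nat.zero_le m),
        Kernel.partialTraj_succ_eq_comp (Nat.zero_le m), ih (by omega),
        Kernel.partialTraj_succ_self, Kernel.partialTraj_succ_self, hk]
  unfold chainLaw Kernel.trajMeasure
  rw [Measure.map_comp _ _ (by fun_prop), Measure.map_comp _ _ (by fun_prop),
    Kernel.traj_map_frestrictLe, Kernel.traj_map_frestrictLe, key n le_rfl]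

/-- The law of a chain driven by a sequence of bits is a measurable function of the sequence. -/
theorem measurable_chainLaw (init : Bool → PMF X) (step : Bool → X → PMF X) :
    Measurable fun lam : ℕ → Bool => chainLaw (init (lam 0)) fun t => step (lam (t + 1)) := by
  refine Measurable.measure_of_isPiSystem_of_isProbabilityMeasure
    (generateFrom_measurableCylinders (α := fun _ : ℕ => X)).symm
    isPiSystem_measurableCylinders fun t ht => ?_
  obtain ⟨n, U, hU, rfl⟩ : ∃ n U, MeasurableSet U ∧
      t = cylinder (α := fun _ : ℕ => X) (Finset.Iic n) U := by
    simpa [measurableCylinders_nat] using ht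
  let ext : ((i : Finset.Iic n) → Bool) → ℕ → Bool := fun x k =>
    if hk : k ∈ Finset.Iic n then x ⟨k, hk⟩ else true
  have heq : (fun lam : ℕ → Bool => (chainLaw (init (lam 0)) fun t => step (lam (t + 1)))
      (cylinder (α := fun _ : ℕ => X) (Finset.Iic n) U)) =
      (fun x : (i : Finset.Iic n) → Bool =>
        (chainLaw (init (ext x 0)) fun t => step (ext x (t + 1)))
          (cylinder (α := fun _ : ℕ => X) (Finset.Iic n) U)) ∘
      (fun lam : ℕ → Bool => fun i : Finset.Iic n => lam i) := by
    funext lam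
    have h0 : ext (fun i : Finset.Iic n => lam i) 0 = lam 0 := by simp [ext]
    have hs : ∀ k < n, ext (fun i : Finset.Iic n => lam i) (k + 1) = lam (k + 1) := by
      intro k hk
      have : k + 1 ≤ n := hk
      simp [ext, this]
    have hc := map_frestrictLe_chainLaw_congr (init (lam 0))
      (step := fun t => step (lam (t + 1)))
      (step' := fun t => step (ext (fun i : Finset.Iic n => lam i) (t + 1))) n
      (fun k hk => by simp only [hs k hk])
    have hc' := congrArg (fun ν => ν U) hc
    rw [Measure.map_apply (Preorder.measurable_frestrictLe (X := fun _ : ℕ => X) n) hU,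
      Measure.map_apply (Preorder.measurable_frestrictLe (X := fun _ : ℕ => X) n) hU] at hc'
    simp only [Function.comp, h0]
    exact hc'
  rw [heq]
  exact (measurable_of_countable _).comp
    (measurable_pi_lambda _ fun i => measurable_pi_apply _)

end Chain

/-- A Markov decision process with states `S` and actions `A`. -/
structure MDP (S A : Type*) where
  /-- the initial state -/
  init : S
  /-- the transition probabilities -/
  trans : S → A → PMF S

section Team

variable {ι : Type*} [Fintype ι] [DecidableEq ι] {S A : ι → Type*}
  [∀ i, Fintype (S i)] [∀ i, Fintype (A i)]

/-- A pair of a joint state and a joint action. -/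
abbrev Joint (S A : ι → Type*) := (∀ i, S i) × (∀ i, A i)

/-- The configuration of the team in one time step, once the actions have been chosen. For each
agent `i` it holds the pair of the joint state and the joint action that agent `i` believes in:
`(c i).1 j` is the true state of agent `i` when `j = i`, and otherwise the state of its (possibly
imaginary) copy of agent `j`; `(c i).2` is the joint action decided upon by agent `i`, which
executes only the component `(c i).2 i`. -/
abbrev Config (S A : ι → Type*) := ι → Joint S A

/-- The joint initial state. -/
def jointInit (M : ∀ i, MDP (S i) (A i)) : ∀ i, S i := fun i => (M i).init

/-- The joint transition function: the agents move independently. -/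
def jointTrans (M : ∀ i, MDP (S i) (A i)) (s : ∀ i, S i) (a : ∀ i, A i) : PMF (∀ i, S i) :=
  prodPMF fun i => (M i).trans (s i) (a i)

/-- At the joint state `s`, draw a joint action from the joint policy `π`. -/
def act (π : (∀ i, S i) → PMF (∀ i, A i)) (s : ∀ i, S i) : PMF (Joint S A) :=
  (π s).map fun a => (s, a)

/-- From a joint state and a joint action, draw the next joint state, then a joint action. -/
def moveAct (M : ∀ i, MDP (S i) (A i)) (π : (∀ i, S i) → PMF (∀ i, A i)) (x : Joint S A) :
    PMF (Joint S A) :=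
  (jointTrans M x.1 x.2).bind (act π)

/-- The true joint state of the team and the joint action it actually executes. -/
def actual (c : Config S A) : Joint S A := (fun i => (c i).1 i, fun i => (c i).2 i)

/-- Time step `0`. With communication the team decides jointly on one action, known to all;
without, every agent draws a joint action of its own. In both cases the initial joint state is
known to all. -/
def roundZero (M : ∀ i, MDP (S i) (A i)) (π : (∀ i, S i) → PMF (∀ i, A i)) :
    Bool → PMF (Config S A)
  | true => (act π (jointInit M)).map fun x => fun _ => x
  | false => prodPMF fun _ => act π (jointInit M)

/-- A time step `t ≥ 1`, given the configuration at time `t - 1`. With communication, the true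
states move according to the executed actions, they are shared, and one joint action is drawn and
becomes known to all. Without communication, the agents act independently of each other: agent `i`
moves from its true state by its own action, samples the next states of its imaginary teammates
from their imagined states and actions, and draws a joint action at the joint state so obtained. -/
def roundSucc (M : ∀ i, MDP (S i) (A i)) (π : (∀ i, S i) → PMF (∀ i, A i)) :
    Bool → Config S A → PMF (Config S A)
  | true, c => (moveAct M π (actual c)).map fun x => fun _ => x
  | false, c => prodPMF fun i => moveAct M π (c i)

variable [∀ i, MeasurableSpace (S i)] [∀ i, MeasurableSingletonClass (S i)]
  [∀ i, MeasurableSpace (A i)] [∀ i, MeasurableSingletonClass (A i)]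

/-- The distribution of joint paths when the joint policy is executed with full communication. -/
def fullPathDist (M : ∀ i, MDP (S i) (A i)) (π : (∀ i, S i) → PMF (∀ i, A i)) :
    Measure (ℕ → Joint S A) :=
  chainLaw (act π (jointInit M)) fun _ => moveAct M π

/-- The distribution of the joint paths, made of the true states and the executed actions, when
communication is available exactly in the time steps `t` with `comm t = true`. -/
def executionDist (M : ∀ i, MDP (S i) (A i)) (π : (∀ i, S i) → PMF (∀ i, A i)) (comm : ℕ → Bool) :
    Measure (ℕ → Joint S A) :=
  (chainLaw (roundZero M π (comm 0)) fun t => roundSucc M π (comm (t + 1))).map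
    fun ω t => actual (ω t)

/-- The path distribution depends measurably on the sequence of availabilities, so that it can be
averaged over a random sequence. -/
theorem measurable_executionDist (M : ∀ i, MDP (S i) (A i)) (π : (∀ i, S i) → PMF (∀ i, A i)) :
    Measurable fun comm : ℕ → Bool => executionDist M π comm :=
  (Measure.measurable_map _ (measurable_pi_lambda _ fun t =>
    (measurable_of_countable actual).comp (measurable_pi_apply t))).comp
    (measurable_chainLaw (roundZero M π) (roundSucc M π))

/-- Intermittent communication with the sequence `lam` of availabilities. -/
def intPathDist (M : ∀ i, MDP (S i) (A i)) (π : (∀ i, S i) → PMF (∀ i, A i)) (lam : ℕ → Bool) :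
    Measure (ℕ → Joint S A) :=
  executionDist M π lam

/-- Imaginary play: communication is available before time `tloss`, and from time `tloss` on it is
lost for ever. -/
def imgPathDist (M : ∀ i, MDP (S i) (A i)) (π : (∀ i, S i) → PMF (∀ i, A i)) (tloss : ℕ∞) :
    Measure (ℕ → Joint S A) :=
  open Classical in executionDist M π fun t => decide ((t : ℕ∞) < tloss)

/-- The mixture `𝔼_Λ[Γ_Λ]` of the path distributions under intermittent communication, for a
random sequence `lam` of communication availabilities on a probability space `(Ω, P)`. -/
def avgIntPathDist {Ω : Type*} [MeasurableSpace Ω] (P : Measure Ω)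
    (M : ∀ i, MDP (S i) (A i)) (π : (∀ i, S i) → PMF (∀ i, A i)) (lam : ℕ → Ω → Bool) :
    Measure (ℕ → Joint S A) :=
  P.bind fun ω => intPathDist M π fun t => lam t ω

end Team

end TeamComm

end

/-! Write P for the law under full communication. Given the executed path, the agents'
configurations are independent, and that of agent i is distributed as the current term of P given
what agent i knows: its own states and actions, and the whole joint path up to the last
communication (`configLaw_real_posterior`). Hence, along prefixes possible under P, the execution
law multiplies at each time by the joint conditional probability of P if communication is available,
and otherwise by the product over the agents of the conditional probabilities, under P, of their own
parts given their own knowledge (`isTeamLaw_executionDist`).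

By the chain rule, the divergence of prefixes is a sum over times of expected log-ratios
(`IsTeamLaw.prefixDiv_eq`). The summand vanishes at times with communication. At the others, Gibbs'
inequality (`integral_log_le_integral_log_cond`) says that finer knowledge predicts at least as well
on average, so the summand is at most the loss `predLoss` of agents that never communicate. These
losses are nonnegative, again by Gibbs, because a product of local predictions is a sub-probability
on joint terms.

The sums of `predLoss` are exactly the prefix divergences for imaginary play, and these are bounded
by the full divergence by data processing. Dropping the times with communication gives (1) on
prefixes. For (2), convexity in the second argument (`prefixDiv_bind_le`) reduces to the average
over availabilities, where each loss is counted with probability q. Finally,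
`klDiv_le_of_forall_prefix` carries a uniform bound on prefix divergences over to infinite paths by
martingale convergence and Fatou's lemma. -/

noncomputable section

namespace TeamComm

/-! ### From divergences of finite prefixes to divergences of infinite sequences. -/

section Limit

open InformationTheory Preorder Filter
open scoped Topology NNReal

/-- Above a large threshold, the identity is a small multiple of `klFun`. -/
theorem le_mul_klFun {δ x : ℝ} (hδ : 0 < δ) (hx : Real.exp (1 + δ⁻¹) ≤ x) :
    x ≤ δ * klFun x := by
  have hx0 : 0 < x := (Real.exp_pos _).trans_le hx
  have hlog : 1 + δ⁻¹ ≤ Real.log x := (Real.le_log_iff_exp_le hx0).2 hx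
  have h1 : x * (1 + δ⁻¹) ≤ x * Real.log x := mul_le_mul_of_nonneg_left hlog hx0.le
  have h2 : x * δ⁻¹ ≤ klFun x := by rw [klFun_apply]; linarith
  calc x = δ * (x * δ⁻¹) := by field_simp
    _ ≤ δ * klFun x := mul_le_mul_of_nonneg_left h2 hδ.le

variable {X : Type*} [MeasurableSpace X] (P Q : Measure (ℕ → X))

/-- The density of `P` with respect to `Q` on the events which depend on the times up to `n`. -/
def prefixDensity (n : ℕ) (ω : ℕ → X) : ℝ :=
  ((P.map (frestrictLe (π := fun _ : ℕ => X) n)).rnDeriv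
    (Q.map (frestrictLe (π := fun _ : ℕ => X) n)) (frestrictLe (π := fun _ : ℕ => X) n ω)).toReal

theorem prefixDensity_nonneg (n : ℕ) (ω : ℕ → X) : 0 ≤ prefixDensity P Q n ω :=
  ENNReal.toReal_nonneg

theorem measurable_prefixDensity (n : ℕ) : Measurable (prefixDensity P Q n) := by
  unfold prefixDensity
  exact ((Measure.measurable_rnDeriv _ _).comp (measurable_frestrictLe n)).ennreal_toReal

theorem stronglyMeasurable_prefixDensity (n : ℕ) :
    StronglyMeasurable[Filtration.piLE (X := fun _ : ℕ => X) n] (prefixDensity P Q n) := by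
  rw [Filtration.piLE_eq_comap_frestrictLe]
  have h : Measurable[MeasurableSpace.comap (frestrictLe (π := fun _ : ℕ => X) n) inferInstance]
      (prefixDensity P Q n) :=
    ((Measure.measurable_rnDeriv _ _).ennreal_toReal).comp (comap_measurable _)
  exact h.stronglyMeasurable

theorem integrable_prefixDensity [IsProbabilityMeasure P] (n : ℕ) : Integrable (prefixDensity P Q n) Q := by
  have : IsProbabilityMeasure (P.map (frestrictLe (π := fun _ : ℕ => X) n)) :=
    Measure.isProbabilityMeasure_map (by fun_prop)
  have h := (Measure.integrable_toReal_rnDeriv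
    (μ := P.map (frestrictLe (π := fun _ : ℕ => X) n))
    (ν := Q.map (frestrictLe (π := fun _ : ℕ => X) n)))
  exact h.comp_measurable (measurable_frestrictLe n)

variable [IsProbabilityMeasure P] [IsProbabilityMeasure Q]

/-- An event of the first n+1 terms is also an event of the first m+1 terms, where the density is a
Radon-Nikodym derivative. That the value does not depend on m is the martingale property of the
densities. -/
theorem setIntegral_prefixDensity {n m : ℕ} (hnm : n ≤ m)
    (hac : P.map (frestrictLe (π := fun _ : ℕ => X) m) ≪
      Q.map (frestrictLe (π := fun _ : ℕ => X) m)) {s : Set (ℕ → X)}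
    (hs : MeasurableSet[Filtration.piLE (X := fun _ : ℕ => X) n] s) :
    ∫ ω in s, prefixDensity P Q m ω ∂Q = P.real s := by
  have hs' := (Filtration.piLE (X := fun _ : ℕ => X)).mono hnm s hs
  rw [Filtration.piLE_eq_comap_frestrictLe] at hs'
  obtain ⟨T, hT, rfl⟩ := hs'
  have : IsProbabilityMeasure (P.map (frestrictLe (π := fun _ : ℕ => X) m)) :=
    Measure.isProbabilityMeasure_map (by fun_prop)
  have h := setIntegral_map (μ := Q) (g := frestrictLe (π := fun _ : ℕ => X) m) hT
    (f := fun h => ((P.map (frestrictLe (π := fun _ : ℕ => X) m)).rnDeriv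
      (Q.map (frestrictLe (π := fun _ : ℕ => X) m)) h).toReal)
    (Measure.measurable_rnDeriv _ _).ennreal_toReal.aestronglyMeasurable
    (measurable_frestrictLe m).aemeasurable
  have h2 := Measure.setIntegral_toReal_rnDeriv hac T
  unfold prefixDensity
  rw [← h, h2, map_measureReal_apply (measurable_frestrictLe m) hT]

theorem lintegral_klFun_prefixDensity {n : ℕ}
    (hac : P.map (frestrictLe (π := fun _ : ℕ => X) n) ≪
      Q.map (frestrictLe (π := fun _ : ℕ => X) n)) :
    ∫⁻ ω, ENNReal.ofReal (klFun (prefixDensity P Q n ω)) ∂Q =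
      klDiv (P.map (frestrictLe (π := fun _ : ℕ => X) n))
        (Q.map (frestrictLe (π := fun _ : ℕ => X) n)) := by
  have : IsProbabilityMeasure (P.map (frestrictLe (π := fun _ : ℕ => X) n)) :=
    Measure.isProbabilityMeasure_map (by fun_prop)
  have : IsProbabilityMeasure (Q.map (frestrictLe (π := fun _ : ℕ => X) n)) :=
    Measure.isProbabilityMeasure_map (by fun_prop)
  rw [klDiv_eq_lintegral_klFun_of_ac hac, lintegral_map (by fun_prop) (by fun_prop)]
  rfl

/-- Densities with bounded divergences are uniformly integrable. -/
theorem uniformIntegrable_of_lintegral_klFun_le {Ω : Type*} [MeasurableSpace Ω] {μ : Measure Ω}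
    [IsFiniteMeasure μ] {f : ℕ → Ω → ℝ} (hf : ∀ n, Measurable (f n)) (hf0 : ∀ n ω, 0 ≤ f n ω)
    {C : ℝ≥0∞} (hC : C ≠ ∞) (h : ∀ n, ∫⁻ ω, ENNReal.ofReal (klFun (f n ω)) ∂μ ≤ C) :
    UniformIntegrable f 1 μ := by
  refine uniformIntegrable_of le_rfl (by simp) (fun n => (hf n).aestronglyMeasurable) ?_
  intro ε hε
  have hC0 : 0 < C.toReal + 1 := by positivity
  -- All that is needed is δ * C ≤ ε; the added 1 keeps the denominator positive when C = 0.
  set δ := ε / (C.toReal + 1) with hδ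
  have hδ0 : 0 < δ := by positivity
  refine ⟨(Real.exp (1 + δ⁻¹)).toNNReal, fun n => ?_⟩
  have hmem : ∀ ω, ω ∈ {x | (Real.exp (1 + δ⁻¹)).toNNReal ≤ ‖f n x‖₊} ↔
      Real.exp (1 + δ⁻¹) ≤ f n ω := fun ω => by
    rw [Set.mem_ofPred_eq, Real.toNNReal_le_iff_le_coe, coe_nnnorm,
      Real.norm_of_nonneg (hf0 n ω)]
  rw [eLpNorm_one_eq_lintegral_enorm]
  calc ∫⁻ ω, ‖Set.indicator _ (f n) ω‖ₑ ∂μ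
      ≤ ∫⁻ ω, ENNReal.ofReal δ * ENNReal.ofReal (klFun (f n ω)) ∂μ := by
        refine lintegral_mono fun ω => ?_
        by_cases hω : Real.exp (1 + δ⁻¹) ≤ f n ω
        · rw [Set.indicator_of_mem ((hmem ω).2 hω), Real.enorm_of_nonneg (hf0 n ω),
            ← ENNReal.ofReal_mul hδ0.le]
          exact ENNReal.ofReal_le_ofReal (le_mul_klFun hδ0 hω)
        · rw [Set.indicator_of_notMem (mt (hmem ω).1 hω)]
          simp
    _ = ENNReal.ofReal δ * ∫⁻ ω, ENNReal.ofReal (klFun (f n ω)) ∂μ :=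
        lintegral_const_mul _ ((measurable_klFun.comp (hf n)).ennreal_ofReal)
    _ ≤ ENNReal.ofReal δ * C := by gcongr; exact h n
    _ = ENNReal.ofReal (δ * C.toReal) := by
        rw [ENNReal.ofReal_mul hδ0.le, ENNReal.ofReal_toReal hC]
    _ ≤ ENNReal.ofReal ε := by
        refine ENNReal.ofReal_le_ofReal ?_
        rw [hδ, div_mul_eq_mul_div, div_le_iff₀ hC0]
        nlinarith

/-- The Kullback-Leibler divergence of laws of sequences is at most any bound on the divergences
of the laws of their finite prefixes. -/
theorem klDiv_le_of_forall_prefix {C : ℝ≥0∞}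
    (h : ∀ n, klDiv (P.map (frestrictLe (π := fun _ : ℕ => X) n))
      (Q.map (frestrictLe (π := fun _ : ℕ => X) n)) ≤ C) : klDiv P Q ≤ C := by
  rcases eq_or_ne C ∞ with rfl | hC
  · exact le_top
  have hac : ∀ n, P.map (frestrictLe (π := fun _ : ℕ => X) n) ≪
      Q.map (frestrictLe (π := fun _ : ℕ => X) n) := fun n =>
    (klDiv_ne_top_iff.1 ((h n).trans_lt hC.lt_top).ne).1
  have hkl : ∀ n, ∫⁻ ω, ENNReal.ofReal (klFun (prefixDensity P Q n ω)) ∂Q ≤ C := fun n =>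
    (lintegral_klFun_prefixDensity P Q (hac n)).trans_le (h n)
  set ℱ : Filtration ℕ _ := Filtration.piLE (X := fun _ : ℕ => X)
  set f := prefixDensity P Q
  have hUI : UniformIntegrable f 1 Q := uniformIntegrable_of_lintegral_klFun_le
    (measurable_prefixDensity P Q) (prefixDensity_nonneg P Q) hC hkl
  have hmart : Martingale f ℱ Q := by
    refine martingale_of_setIntegral_eq_succ (stronglyMeasurable_prefixDensity P Q)
      (integrable_prefixDensity P Q) fun n s hs => ?_
    rw [setIntegral_prefixDensity P Q le_rfl (hac n) hs,
      setIntegral_prefixDensity P Q n.le_succ (hac _) hs]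
  set g := Filtration.limitProcess f ℱ Q
  have hlim : ∀ᵐ ω ∂Q, Tendsto (fun n => f n ω) atTop (𝓝 (g ω)) :=
    hmart.submartingale.ae_tendsto_limitProcess_of_uniformIntegrable hUI
  have hgm : Measurable g := by
    have : StronglyMeasurable[⨆ n, ℱ n] g :=
      Filtration.stronglyMeasurable_limitProcess
    exact (this.mono (iSup_le fun n => ℱ.le n)).measurable
  have hg0 : 0 ≤ᵐ[Q] g := by
    filter_upwards [hlim] with ω hω
    exact ge_of_tendsto' hω fun n => prefixDensity_nonneg P Q n ω
  have hgi : Integrable g Q := by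
    obtain ⟨R, hR⟩ := hUI.2.2
    exact (Filtration.memLp_limitProcess_of_eLpNorm_bdd
      (fun n => (hUI.1 n)) hR).integrable le_rfl
  -- Uniform integrability makes each `f n` a conditional expectation of the limit `g`, so `g` keeps
  -- the integrals over prefix events.
  have hset : ∀ n s, MeasurableSet[ℱ n] s → ∫ ω in s, g ω ∂Q = P.real s := by
    intro n s hs
    rw [← setIntegral_prefixDensity P Q le_rfl (hac n) hs, ← setIntegral_condExp (ℱ.le n) hgi hs]
    exact setIntegral_congr_ae (ℱ.le n s hs)
      ((hmart.ae_eq_condExp_limitProcess hUI n).mono fun ω hω _ => hω.symm)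
  have hset' : ∀ n s, MeasurableSet[ℱ n] s →
      Q.withDensity (fun ω => ENNReal.ofReal (g ω)) s = P s := by
    intro n s hs
    rw [withDensity_apply _ (ℱ.le n s hs),
      ← ofReal_integral_eq_lintegral_ofReal hgi.integrableOn (ae_restrict_of_ae hg0),
      hset n s hs, ofReal_measureReal]
  -- The prefix events form a generating π-system, so `g` is the density of P. In particular P ≪ Q
  -- is derived here and not assumed.
  have hP : Q.withDensity (fun ω => ENNReal.ofReal (g ω)) = P := by
    have huniv := hset' 0 Set.univ MeasurableSet.univ
    have : IsFiniteMeasure (Q.withDensity (fun ω => ENNReal.ofReal (g ω))) :=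
      ⟨by rw [huniv]; exact measure_lt_top _ _⟩
    refine ext_of_generate_finite (measurableCylinders fun _ : ℕ => X)
      generateFrom_measurableCylinders.symm isPiSystem_measurableCylinders (fun s hs => ?_) huniv
    obtain ⟨n, U, hU, rfl⟩ : ∃ n U, MeasurableSet U ∧
        s = cylinder (α := fun _ : ℕ => X) (Finset.Iic n) U := by
      simpa [measurableCylinders_nat] using hs
    refine hset' n _ ?_
    change MeasurableSet[Filtration.piLE (X := fun _ : ℕ => X) n] _
    rw [Filtration.piLE_eq_comap_frestrictLe]
    exact ⟨U, hU, rfl⟩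
  have hPQ : P ≪ Q := hP ▸ withDensity_absolutelyContinuous _ _
  have hrn : P.rnDeriv Q =ᵐ[Q] fun ω => ENNReal.ofReal (g ω) := by
    have := Measure.rnDeriv_withDensity Q hgm.ennreal_ofReal
    rwa [hP] at this
  calc klDiv P Q = ∫⁻ ω, ENNReal.ofReal (klFun (P.rnDeriv Q ω).toReal) ∂Q :=
        klDiv_eq_lintegral_klFun_of_ac hPQ
    _ = ∫⁻ ω, liminf (fun n => ENNReal.ofReal (klFun (f n ω))) atTop ∂Q := by
        refine lintegral_congr_ae ?_
        filter_upwards [hrn, hlim, hg0] with ω h1 h2 h3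
        rw [h1, ENNReal.toReal_ofReal h3]
        have hc : Continuous fun x => ENNReal.ofReal (klFun x) :=
          ENNReal.continuous_ofReal.comp continuous_klFun
        exact ((hc.tendsto _).comp h2).liminf_eq.symm
    _ ≤ liminf (fun n => ∫⁻ ω, ENNReal.ofReal (klFun (f n ω)) ∂Q) atTop :=
        lintegral_liminf_le fun n =>
          (measurable_klFun.comp (measurable_prefixDensity P Q n)).ennreal_ofReal
    _ ≤ C := by
        refine (liminf_le_liminf (Eventually.of_forall hkl)).trans ?_
        simp

end Limit

/-! ### Gibbs' inequality for finite-valued observables. -/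

section Gibbs

variable {Ω α β : Type*} [MeasurableSpace Ω] {P : Measure Ω} [IsProbabilityMeasure P]

theorem integral_comp_fintype {γ : Type*} [Fintype γ] {Z : Ω → γ}
    (hZ : ∀ z, MeasurableSet (Z ⁻¹' {z})) (f : γ → ℝ) :
    Integrable (fun ω => f (Z ω)) P ∧
      ∫ ω, f (Z ω) ∂P = ∑ z, P.real (Z ⁻¹' {z}) * f z := by
  let _ : MeasurableSpace γ := ⊤
  have hZm : Measurable Z := measurable_to_countable' hZ
  have : IsProbabilityMeasure (P.map Z) := Measure.isProbabilityMeasure_map hZm.aemeasurable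
  have hfi : Integrable f (P.map Z) := Integrable.of_finite
  refine ⟨hfi.comp_measurable hZm, ?_⟩
  rw [← integral_map (f := f) hZm.aemeasurable hfi.1, integral_fintype hfi]
  refine Finset.sum_congr rfl fun z _ => ?_
  rw [map_measureReal_apply hZm (measurableSet_singleton z), smul_eq_mul]

theorem sum_measureReal_fiber {γ : Type*} [Fintype γ] {Z : Ω → γ}
    (hZ : ∀ z, MeasurableSet (Z ⁻¹' {z})) : ∑ z, P.real (Z ⁻¹' {z}) = 1 := by
  have h := (integral_comp_fintype (P := P) hZ fun _ => (1 : ℝ)).2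
  simpa using h.symm

/-- **Gibbs' inequality**: among all predictions of `B` given `A`, the conditional probability has
the largest expected logarithm. -/
theorem integral_log_le_integral_log_cond [Fintype α] [Fintype β] {A : Ω → α} {B : Ω → β}
    (hA : ∀ a, MeasurableSet (A ⁻¹' {a})) (hB : ∀ b, MeasurableSet (B ⁻¹' {b}))
    {F : α → β → ℝ} (hF0 : ∀ a b, 0 ≤ F a b) (hF1 : ∀ a, ∑ b, F a b ≤ 1)
    (hF : ∀ a b, P.real (A ⁻¹' {a} ∩ B ⁻¹' {b}) ≠ 0 → F a b ≠ 0) :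
    ∫ ω, Real.log (F (A ω) (B ω)) ∂P ≤
      ∫ ω, Real.log (P.real (A ⁻¹' {A ω} ∩ B ⁻¹' {B ω}) / P.real (A ⁻¹' {A ω})) ∂P := by
  have hpre : ∀ z : α × β, (fun ω => (A ω, B ω)) ⁻¹' {z} = A ⁻¹' {z.1} ∩ B ⁻¹' {z.2} := by
    rintro ⟨a, b⟩
    ext ω
    simp
  have hZ : ∀ z : α × β, MeasurableSet ((fun ω => (A ω, B ω)) ⁻¹' {z}) := fun z => by
    rw [hpre]
    exact (hA _).inter (hB _)
  have h1 := (integral_comp_fintype (P := P) hZ fun z => Real.log (F z.1 z.2)).2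
  have h2 := (integral_comp_fintype (P := P) hZ fun z =>
    Real.log (P.real (A ⁻¹' {z.1} ∩ B ⁻¹' {z.2}) / P.real (A ⁻¹' {z.1}))).2
  have h3 := sum_measureReal_fiber (P := P) hZ
  have h4 := sum_measureReal_fiber (P := P) hA
  simp only [hpre] at h1 h2 h3
  rw [h1, h2]
  -- This is log t ≤ t - 1 at t = F / (p / r), multiplied by p; a term with p = 0 only needs r F ≥
  -- 0. The correction r F - p sums to at most 1 - 1 = 0.
  have hterm : ∀ z : α × β,
      P.real (A ⁻¹' {z.1} ∩ B ⁻¹' {z.2}) * Real.log (F z.1 z.2) ≤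
        P.real (A ⁻¹' {z.1} ∩ B ⁻¹' {z.2}) *
          Real.log (P.real (A ⁻¹' {z.1} ∩ B ⁻¹' {z.2}) / P.real (A ⁻¹' {z.1})) +
        (P.real (A ⁻¹' {z.1}) * F z.1 z.2 - P.real (A ⁻¹' {z.1} ∩ B ⁻¹' {z.2})) := by
    rintro ⟨a, b⟩
    dsimp only
    set p := P.real (A ⁻¹' {a} ∩ B ⁻¹' {b}) with hp
    set r := P.real (A ⁻¹' {a}) with hr
    have hr0 : 0 ≤ r := measureReal_nonneg
    rcases eq_or_ne p 0 with h0 | h0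
    · rw [h0]
      simpa using mul_nonneg hr0 (hF0 a b)
    · have hp0 : 0 < p := lt_of_le_of_ne measureReal_nonneg (Ne.symm h0)
      have hpr : p ≤ r := measureReal_mono Set.inter_subset_left
      have hr1 : 0 < r := hp0.trans_le hpr
      have hf : 0 < F a b := lt_of_le_of_ne (hF0 a b) (Ne.symm (hF a b h0))
      have hlog := Real.log_le_sub_one_of_pos (div_pos hf (div_pos hp0 hr1))
      rw [Real.log_div hf.ne' (div_pos hp0 hr1).ne'] at hlog
      have := mul_le_mul_of_nonneg_left hlog hp0.le
      have he : p * (F a b / (p / r) - 1) = r * F a b - p := by field_simp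
      rw [he] at this
      linarith
  refine (Finset.sum_le_sum fun z _ => hterm z).trans ?_
  rw [Finset.sum_add_distrib, Finset.sum_sub_distrib, h3]
  have h5 : ∑ z : α × β, P.real (A ⁻¹' {z.1}) * F z.1 z.2 ≤ 1 := by
    rw [← h4, Fintype.sum_prod_type]
    refine Finset.sum_le_sum fun a _ => ?_
    simp only [← Finset.mul_sum]
    exact mul_le_of_le_one_right measureReal_nonneg (hF1 a)
  linarith

end Gibbs

/-! ### Events and functions determined by finitely many terms. -/

section Prefix

variable {X : Type*}

/-- The sequences which agree with `ω` before time `n`. -/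
def prefixCyl (n : ℕ) (ω : ℕ → X) : Set (ℕ → X) := {ω' | ∀ k < n, ω' k = ω k}

theorem mem_prefixCyl {n : ℕ} {ω ω' : ℕ → X} : ω' ∈ prefixCyl n ω ↔ ∀ k < n, ω' k = ω k :=
  Iff.rfl

theorem prefixCyl_zero (ω : ℕ → X) : prefixCyl 0 ω = Set.univ := by
  ext; simp [mem_prefixCyl]

theorem prefixCyl_succ (n : ℕ) (ω : ℕ → X) :
    prefixCyl (n + 1) ω = prefixCyl n ω ∩ {ω' | ω' n = ω n} := by
  ext ω'
  change (∀ k < n + 1, _) ↔ (∀ k < n, _) ∧ ω' n = ω n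
  constructor
  · exact fun h => ⟨fun k hk => h k (by omega), h n (by omega)⟩
  · rintro ⟨h, h'⟩ k hk
    rcases Nat.lt_succ_iff_lt_or_eq.1 hk with hk | rfl
    exacts [h k hk, h']

theorem prefixCyl_anti {m n : ℕ} (hmn : m ≤ n) (ω : ℕ → X) : prefixCyl n ω ⊆ prefixCyl m ω :=
  fun _ h k hk => h k (hk.trans_le hmn)

theorem prefixCyl_congr {n : ℕ} {ω ω' : ℕ → X} (h : ∀ k < n, ω k = ω' k) :
    prefixCyl n ω = prefixCyl n ω' := by
  ext u
  exact forall₂_congr fun k hk => by rw [h k hk]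

theorem prefixCyl_eq_preimage (n : ℕ) (ω : ℕ → X) :
    prefixCyl n ω = (fun (u : ℕ → X) (k : Fin n) => u k) ⁻¹' {fun k : Fin n => ω k} := by
  ext u
  simp [mem_prefixCyl, funext_iff, Fin.forall_iff]

variable [MeasurableSpace X] [MeasurableSingletonClass X]

/-- Such a set is the preimage of a subset of the countable space of words of length n, where every
set is measurable. -/
theorem measurableSet_of_prefix [Countable X] {B : Set (ℕ → X)} (n : ℕ)
    (h : ∀ ω ω', (∀ k < n, ω k = ω' k) → ω ∈ B → ω' ∈ B) : MeasurableSet B := by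
  have hr : Measurable fun (u : ℕ → X) (k : Fin n) => u k :=
    measurable_pi_lambda _ fun k => measurable_pi_apply _
  have hB : B = (fun (u : ℕ → X) (k : Fin n) => u k) ⁻¹'
      ((fun (u : ℕ → X) (k : Fin n) => u k) '' B) := by
    refine (Set.subset_preimage_image _ _).antisymm ?_
    rintro ω ⟨u, hu, huω⟩
    exact h u ω (fun k hk => congrFun huω ⟨k, hk⟩) hu
  rw [hB]
  exact hr (Set.to_countable _).measurableSet

theorem measurableSet_prefixCyl [Countable X] (n : ℕ) (ω : ℕ → X) :
    MeasurableSet (prefixCyl n ω) :=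
  measurableSet_of_prefix n fun _ _ h hu k hk => (h k hk).symm.trans (hu k hk)

variable [Finite X]

theorem integrable_of_prefix (P : Measure (ℕ → X)) [IsFiniteMeasure P] {f : (ℕ → X) → ℝ} (n : ℕ)
    (h : ∀ ω ω', (∀ k < n, ω k = ω' k) → f ω = f ω') : Integrable f P := by
  have hr : Measurable fun (u : ℕ → X) (k : Fin n) => u k :=
    measurable_pi_lambda _ fun k => measurable_pi_apply _
  have hf : f.FactorsThrough fun (u : ℕ → X) (k : Fin n) => u k :=
    fun u u' huu' => h u u' fun k hk => congrFun huu' ⟨k, hk⟩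
  have he : f = (Function.extend (fun (u : ℕ → X) (k : Fin n) => u k) f 0) ∘
      (fun (u : ℕ → X) (k : Fin n) => u k) := by
    funext u
    exact (hf.extend_apply 0 u).symm
  rw [he]
  exact (Integrable.of_finite (μ := P.map fun (u : ℕ → X) (k : Fin n) => u k)).comp_measurable hr

/-- There are finitely many words of each length, so the null ones together have measure zero.
Almost everywhere this makes the conditional probabilities and their logarithms genuine, free of the
conventions for division by 0 and log 0. -/
theorem ae_prefixCyl_ne_zero (P : Measure (ℕ → X)) [IsFiniteMeasure P] :
    ∀ᵐ ω ∂P, ∀ n, P.real (prefixCyl n ω) ≠ 0 := by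
  rw [ae_all_iff]
  intro n
  have hr : Measurable fun (u : ℕ → X) (k : Fin n) => u k :=
    measurable_pi_lambda _ fun k => measurable_pi_apply _
  have h : ∀ᵐ v ∂(P.map fun (u : ℕ → X) (k : Fin n) => u k),
      (P.map fun (u : ℕ → X) (k : Fin n) => u k) {v} ≠ 0 := by
    rw [ae_iff_of_countable]
    exact fun v hv => hv
  filter_upwards [ae_of_ae_map hr.aemeasurable h] with ω hω
  rw [Measure.map_apply hr (measurableSet_singleton _), ← prefixCyl_eq_preimage] at hω
  rw [measureReal_def, ENNReal.toReal_ne_zero]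
  exact ⟨hω, measure_ne_top _ _⟩

end Prefix

/-! ### What the agents know, and how well they predict from it. -/

section Info

variable {ι X : Type*} {Y : ι → Type*} (loc : ∀ i, X → Y i)

/-- The sequences which agent `i`, who observes `loc i` of every term and learns the whole past
whenever communication is available, cannot distinguish from `ω` before time `n`. -/
def infoSet (lam : ℕ → Bool) (i : ι) (n : ℕ) (ω : ℕ → X) : Set (ℕ → X) :=
  {ω' | ∀ k < n, loc i (ω' k) = loc i (ω k) ∧ ∀ m < n, k ≤ m → lam m = true → ω' k = ω k}

/-- The sequences which agent `i` cannot distinguish from `ω` before time `n`, and for which it also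
makes the same observation at time `n`. -/
def infoSetNext (lam : ℕ → Bool) (i : ι) (n : ℕ) (ω : ℕ → X) : Set (ℕ → X) :=
  infoSet loc lam i n ω ∩ {ω' | loc i (ω' n) = loc i (ω n)}

theorem prefixCyl_subset_infoSet (lam : ℕ → Bool) (i : ι) (n : ℕ) (ω : ℕ → X) :
    prefixCyl n ω ⊆ infoSet loc lam i n ω :=
  fun _ h k hk => ⟨congrArg (loc i) (h k hk), fun _ _ _ _ => h k hk⟩

theorem prefixCyl_subset_infoSetNext (lam : ℕ → Bool) (i : ι) (n : ℕ) (ω : ℕ → X) :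
    prefixCyl (n + 1) ω ⊆ infoSetNext loc lam i n ω :=
  fun _ h => ⟨prefixCyl_subset_infoSet loc lam i n ω (prefixCyl_anti n.le_succ ω h),
    congrArg (loc i) (h n n.lt_succ_self)⟩

theorem infoSet_zero (lam : ℕ → Bool) (i : ι) (ω : ℕ → X) : infoSet loc lam i 0 ω = Set.univ :=
  Set.eq_univ_of_forall fun _ k hk => absurd hk (Nat.not_lt_zero k)

/-- Communication at time n reveals every term up to and including time n, so the knowledge of all
agents collapses to the true prefix. -/
theorem infoSet_succ_of_true {lam : ℕ → Bool} (i : ι) {n : ℕ} (h : lam n = true) (ω : ℕ → X) :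
    infoSet loc lam i (n + 1) ω = prefixCyl (n + 1) ω :=
  (prefixCyl_subset_infoSet loc lam i (n + 1) ω).antisymm' fun _ hu k hk =>
    (hu k hk).2 n n.lt_succ_self (Nat.lt_succ_iff.1 hk) h

theorem infoSet_succ_of_false {lam : ℕ → Bool} (i : ι) {n : ℕ} (h : lam n = false) (ω : ℕ → X) :
    infoSet loc lam i (n + 1) ω = infoSetNext loc lam i n ω := by
  ext u
  constructor
  · intro hu
    exact ⟨fun k hk => ⟨(hu k (by omega)).1, fun m hm => (hu k (by omega)).2 m (by omega)⟩,
      (hu n (by omega)).1⟩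
  · rintro ⟨hu, hn⟩ k hk
    have hmn : ∀ m < n + 1, lam m = true → m < n := fun m hm hlam => by
      rcases Nat.lt_succ_iff_lt_or_eq.1 hm with hm | rfl
      · exact hm
      · simp [h] at hlam
    rcases Nat.lt_succ_iff_lt_or_eq.1 hk with hk | rfl
    · exact ⟨(hu k hk).1, fun m hm hkm hlam => (hu k hk).2 m (hmn m hm hlam) hkm hlam⟩
    · exact ⟨hn, fun m hm hkm hlam => absurd (hmn m hm hlam) (by omega)⟩

theorem infoSet_congr {lam : ℕ → Bool} (i : ι) {n : ℕ} {ω ω' : ℕ → X}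
    (h : ∀ k < n, ω k = ω' k) : infoSet loc lam i n ω = infoSet loc lam i n ω' := by
  ext u
  exact forall₂_congr fun k hk => by rw [h k hk]

theorem infoSet_prefix (lam : ℕ → Bool) (i : ι) (n : ℕ) (ω u u' : ℕ → X)
    (h : ∀ k < n, u k = u' k) (hu : u ∈ infoSet loc lam i n ω) : u' ∈ infoSet loc lam i n ω :=
  fun k hk => by
    rw [← h k hk]
    exact hu k hk

theorem infoSetNext_congr {lam : ℕ → Bool} (i : ι) {n : ℕ} {ω ω' : ℕ → X}
    (h : ∀ k < n + 1, ω k = ω' k) : infoSetNext loc lam i n ω = infoSetNext loc lam i n ω' := by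
  unfold infoSetNext
  rw [infoSet_congr loc i fun k hk => h k (by omega), h n (by omega)]

/-- What agent `i` knows before time `n`. -/
def infoMap (lam : ℕ → Bool) (i : ι) (n : ℕ) (ω : ℕ → X) : Fin n → Y i × Option X :=
  open Classical in
  fun k => (loc i (ω k), if ∃ m < n, k ≤ m ∧ lam m = true then some (ω k) else none)

theorem infoSet_eq_fiber (lam : ℕ → Bool) (i : ι) (n : ℕ) (ω : ℕ → X) :
    infoSet loc lam i n ω = infoMap loc lam i n ⁻¹' {infoMap loc lam i n ω} := by
  ext u
  simp only [Set.mem_preimage, Set.mem_singleton_iff, funext_iff, Fin.forall_iff, infoMap,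
    Prod.ext_iff]
  refine forall₂_congr fun k hk => and_congr_right fun _ => ?_
  by_cases h : ∃ m < n, k ≤ m ∧ lam m = true
  · simp only [h, if_true, Option.some.injEq]
    obtain ⟨m, hm, hkm, hlam⟩ := h
    exact ⟨fun hu => hu m hm hkm hlam, fun hu _ _ _ _ => hu⟩
  · simp only [h, if_false, iff_true]
    exact fun m hm hkm hlam => absurd ⟨m, hm, hkm, hlam⟩ h

/-- The event that the observations of agent `i` before time `n` are `a`. -/
def obsSet (i : ι) (n : ℕ) (a : Fin n → Y i) : Set (ℕ → X) := {ω | ∀ k : Fin n, loc i (ω k) = a k}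

theorem infoSet_false_eq (i : ι) (n : ℕ) (ω : ℕ → X) :
    infoSet loc (fun _ => false) i n ω = obsSet loc i n fun k => loc i (ω k) := by
  ext u
  simp [infoSet, obsSet, Fin.forall_iff]

variable [MeasurableSpace X] (P : Measure (ℕ → X))

/-- The conditional probability of the term at time `n`, given the past. -/
def jointPred (n : ℕ) (ω : ℕ → X) : ℝ := P.real (prefixCyl (n + 1) ω) / P.real (prefixCyl n ω)

/-- The conditional probability of the observation of agent `i` at time `n`, given what it knows
before. -/
def localPred (lam : ℕ → Bool) (i : ι) (n : ℕ) (ω : ℕ → X) : ℝ :=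
  P.real (infoSetNext loc lam i n ω) / P.real (infoSet loc lam i n ω)

/-- The prediction of the term at time `n` under intermittent communication. -/
def teamPred [Fintype ι] (lam : ℕ → Bool) (n : ℕ) (ω : ℕ → X) : ℝ :=
  if lam n then jointPred P n ω else ∏ i, localPred loc P lam i n ω

theorem jointPred_congr {n : ℕ} {ω ω' : ℕ → X} (h : ∀ k < n + 1, ω k = ω' k) :
    jointPred P n ω = jointPred P n ω' := by
  unfold jointPred
  rw [prefixCyl_congr h, prefixCyl_congr fun k hk => h k (by omega)]

theorem localPred_congr {lam : ℕ → Bool} {i : ι} {n : ℕ} {ω ω' : ℕ → X}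
    (h : ∀ k < n + 1, ω k = ω' k) :
    localPred loc P lam i n ω = localPred loc P lam i n ω' := by
  unfold localPred
  rw [infoSetNext_congr loc i h, infoSet_congr loc i fun k hk => h k (by omega)]

variable {P} in
theorem jointPred_pos [IsFiniteMeasure P] {n : ℕ} {ω : ℕ → X}
    (h : P.real (prefixCyl (n + 1) ω) ≠ 0) : 0 < jointPred P n ω := by
  have h0 : 0 < P.real (prefixCyl (n + 1) ω) := lt_of_le_of_ne measureReal_nonneg h.symm
  exact div_pos h0 (h0.trans_le (measureReal_mono (prefixCyl_anti n.le_succ ω)))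

variable {P} in
theorem measureReal_infoSet_pos [IsFiniteMeasure P] (lam : ℕ → Bool) (i : ι) {n : ℕ} {ω : ℕ → X}
    (h : P.real (prefixCyl n ω) ≠ 0) : 0 < P.real (infoSet loc lam i n ω) :=
  (lt_of_le_of_ne measureReal_nonneg h.symm).trans_le
    (measureReal_mono (prefixCyl_subset_infoSet loc lam i n ω))

variable {P} in
theorem localPred_pos [IsFiniteMeasure P] (lam : ℕ → Bool) (i : ι) {n : ℕ} {ω : ℕ → X}
    (h : P.real (prefixCyl (n + 1) ω) ≠ 0) : 0 < localPred loc P lam i n ω := by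
  have h0 : 0 < P.real (infoSetNext loc lam i n ω) :=
    (lt_of_le_of_ne measureReal_nonneg h.symm).trans_le
      (measureReal_mono (prefixCyl_subset_infoSetNext loc lam i n ω))
  exact div_pos h0 (h0.trans_le (measureReal_mono Set.inter_subset_left))

variable {P} in
theorem teamPred_pos [Fintype ι] [IsFiniteMeasure P] (lam : ℕ → Bool) {n : ℕ} {ω : ℕ → X}
    (h : P.real (prefixCyl (n + 1) ω) ≠ 0) : 0 < teamPred loc P lam n ω := by
  unfold teamPred
  split_ifs
  · exact jointPred_pos h
  · exact Finset.prod_pos fun i _ => localPred_pos loc lam i h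

theorem localPred_false (i : ι) (n : ℕ) (ω : ℕ → X) :
    localPred loc P (fun _ => false) i n ω =
      P.real (obsSet loc i n (fun k => loc i (ω k)) ∩ {u | loc i (u n) = loc i (ω n)}) /
        P.real (obsSet loc i n fun k => loc i (ω k)) := by
  rw [localPred, infoSetNext, infoSet_false_eq]

variable [MeasurableSingletonClass X]

section

variable [Finite X] [IsFiniteMeasure P]

theorem integrable_log_jointPred (n : ℕ) : Integrable (fun ω => Real.log (jointPred P n ω)) P :=
  integrable_of_prefix P (n + 1) fun _ _ h => by rw [jointPred_congr P h]

theorem integrable_log_localPred (lam : ℕ → Bool) (i : ι) (n : ℕ) :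
    Integrable (fun ω => Real.log (localPred loc P lam i n ω)) P :=
  integrable_of_prefix P (n + 1) fun _ _ h => by rw [localPred_congr loc P h]

theorem integrable_log_teamPred [Fintype ι] (lam : ℕ → Bool) (n : ℕ) :
    Integrable (fun ω => Real.log (teamPred loc P lam n ω)) P :=
  integrable_of_prefix P (n + 1) fun _ _ h => by
    unfold teamPred
    rw [jointPred_congr P h]
    simp only [localPred_congr loc P h]

end

theorem measurableSet_infoSet [Countable X] (lam : ℕ → Bool) (i : ι) (n : ℕ) (ω : ℕ → X) :
    MeasurableSet (infoSet loc lam i n ω) :=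
  measurableSet_of_prefix n (infoSet_prefix loc lam i n ω)

theorem measurableSet_obsSet [Countable X] (i : ι) (n : ℕ) (a : Fin n → Y i) :
    MeasurableSet (obsSet loc i n a) :=
  measurableSet_of_prefix n fun _ _ h hu k => by
    rw [← h k k.2]
    exact hu k

theorem measurableSet_loc_fiber [Countable X] (i : ι) (n : ℕ) (b : Y i) :
    MeasurableSet ((fun ω : ℕ → X => loc i (ω n)) ⁻¹' {b}) :=
  measurableSet_of_prefix (n + 1) fun u u' h (hu : loc i (u n) = b) =>
    show loc i (u' n) = b by rw [← h n n.lt_succ_self]; exact hu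

variable [Fintype X] [∀ i, Fintype (Y i)] [IsProbabilityMeasure P]

/-- The events are disjoint parts of the conditioning event. Only an inequality is claimed: if the
conditioning event is null, all quotients are 0. -/
theorem sum_obs_le_one (i : ι) (n : ℕ) (a : Fin n → Y i) :
    ∑ b, P.real (obsSet loc i n a ∩ {u | loc i (u n) = b}) / P.real (obsSet loc i n a) ≤ 1 := by
  rw [← Finset.sum_div]
  refine div_le_one_of_le₀ ?_ measureReal_nonneg
  rw [← measureReal_biUnion_finset]
  · exact measureReal_mono (Set.iUnion₂_subset fun _ _ => Set.inter_subset_left)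
  · intro b _ b' _ hbb'
    refine Set.disjoint_left.2 ?_
    rintro u ⟨_, hu⟩ ⟨_, hu'⟩
    exact hbb' (hu.symm.trans hu')
  · exact fun b _ => (measurableSet_obsSet loc i n a).inter (measurableSet_loc_fiber loc i n b)

/-- Without communication, the agents predict their observations less well. -/
theorem integral_log_localPred_false_le (lam : ℕ → Bool) (i : ι) (n : ℕ) :
    ∫ ω, Real.log (localPred loc P (fun _ => false) i n ω) ∂P ≤
      ∫ ω, Real.log (localPred loc P lam i n ω) ∂P := by
  -- The prediction without communication reads only the agent's own observations in `infoMap`. It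
  -- is therefore one admissible prediction from the finer knowledge, and Gibbs' inequality compares
  -- it with the best one.
  have h := integral_log_le_integral_log_cond (P := P) (A := infoMap loc lam i n)
    (B := fun ω => loc i (ω n))
    (F := fun a b => P.real (obsSet loc i n (fun k => (a k).1) ∩ {u | loc i (u n) = b}) /
        P.real (obsSet loc i n fun k => (a k).1))
    (fun a => measurableSet_of_prefix n fun u u' h hu => by
      have : infoMap loc lam i n u' = infoMap loc lam i n u := by
        funext k
        simp only [infoMap, h k k.2]
      rwa [Set.mem_preimage, this])
    (measurableSet_loc_fiber loc i n)
    (fun a b => div_nonneg measureReal_nonneg measureReal_nonneg)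
    (fun a => sum_obs_le_one loc P i n _)
    (fun a b hab => by
      have hsub : infoMap loc lam i n ⁻¹' {a} ⊆ obsSet loc i n fun k => (a k).1 := by
        rintro u hu k
        rw [← show infoMap loc lam i n u = a from hu]
        rfl
      have h0 := lt_of_le_of_ne measureReal_nonneg hab.symm
      have h1 := h0.trans_le (measureReal_mono (μ := P) (Set.inter_subset_inter_left _ hsub))
      exact (div_pos h1 (h1.trans_le (measureReal_mono Set.inter_subset_left))).ne')
  simp only [← infoSet_eq_fiber] at h
  simp only [localPred_false]
  exact h

/-- The product of the predictions of the agents is worse than the joint prediction. -/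
theorem integral_log_prod_localPred_false_le [Fintype ι] [DecidableEq ι]
    (hloc : ∀ x x', (∀ i, loc i x = loc i x') → x = x') (n : ℕ) :
    ∫ ω, Real.log (∏ i, localPred loc P (fun _ => false) i n ω) ∂P ≤
      ∫ ω, Real.log (jointPred P n ω) ∂P := by
  have hfib : ∀ a : Fin n → X, MeasurableSet ((fun (ω : ℕ → X) (k : Fin n) => ω k) ⁻¹' {a}) :=
    fun a => measurableSet_of_prefix n fun u u' h hu => by
      have : (fun k : Fin n => u' k) = fun k : Fin n => u k := funext fun k => (h k k.2).symm
      rwa [Set.mem_preimage, this]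
  have h := integral_log_le_integral_log_cond (P := P) (A := fun (ω : ℕ → X) (k : Fin n) => ω k)
    (B := fun ω => ω n)
    (F := fun a b => ∏ i, P.real (obsSet loc i n (fun k => loc i (a k)) ∩
        {u | loc i (u n) = loc i b}) / P.real (obsSet loc i n fun k => loc i (a k)))
    hfib (fun b => measurable_pi_apply n (measurableSet_singleton b))
    (fun a b => Finset.prod_nonneg fun i _ => div_nonneg measureReal_nonneg measureReal_nonneg)
    (fun a => by
      -- A term is determined by the agents' observations, so the sum over terms is part of the sum
      -- over all families of observations. The latter factors into sums that are each at most 1.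
      have hinj : Function.Injective fun (x : X) (i : ι) => loc i x :=
        fun x x' h => hloc x x' (congrFun h)
      have hsum := Finset.sum_le_univ_sum_of_nonneg
        (f := fun y : ∀ i, Y i => ∏ i, P.real (obsSet loc i n (fun k => loc i (a k)) ∩
          {u | loc i (u n) = y i}) / P.real (obsSet loc i n fun k => loc i (a k)))
        (s := Finset.univ.map ⟨_, hinj⟩)
        (fun y => Finset.prod_nonneg fun i _ => div_nonneg measureReal_nonneg measureReal_nonneg)
      rw [Finset.sum_map] at hsum
      refine hsum.trans ?_
      rw [← Fintype.prod_sum fun i y => P.real (obsSet loc i n (fun k => loc i (a k)) ∩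
          {u | loc i (u n) = y}) / P.real (obsSet loc i n fun k => loc i (a k))]
      exact Finset.prod_le_one
        (fun i _ => Finset.sum_nonneg fun _ _ => div_nonneg measureReal_nonneg measureReal_nonneg)
        (fun i _ => sum_obs_le_one loc P i n _))
    (fun a b hab => Finset.prod_ne_zero_iff.2 fun i _ => by
      have hsub : (fun (ω : ℕ → X) (k : Fin n) => ω k) ⁻¹' {a} ∩ (fun ω => ω n) ⁻¹' {b} ⊆
          obsSet loc i n (fun k => loc i (a k)) ∩ {u | loc i (u n) = loc i b} := by
        rintro u ⟨hu, hu'⟩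
        refine ⟨fun k => ?_, congrArg (loc i) hu'⟩
        rw [← show (fun k : Fin n => u k) = a from hu]
      have h0 := lt_of_le_of_ne measureReal_nonneg hab.symm
      have h1 := h0.trans_le (measureReal_mono (μ := P) hsub)
      exact (div_pos h1 (h1.trans_le (measureReal_mono Set.inter_subset_left))).ne')
  have hnext : ∀ ω : ℕ → X, (fun (ω : ℕ → X) (k : Fin n) => ω k) ⁻¹' {fun k : Fin n => ω k} ∩
      (fun ω => ω n) ⁻¹' {ω n} = prefixCyl (n + 1) ω := fun ω => by
    rw [prefixCyl_succ, prefixCyl_eq_preimage]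
    rfl
  simp only [hnext] at h
  simp only [← prefixCyl_eq_preimage] at h
  simp only [localPred_false]
  exact h

end Info

/-! ### The divergence of finite prefixes as an expected log-ratio. -/

section PrefixDivergence

open InformationTheory Preorder

theorem prefixCyl_succ_eq_preimage {X : Type*} (n : ℕ) (ω : ℕ → X) :
    prefixCyl (n + 1) ω = frestrictLe (π := fun _ : ℕ => X) n ⁻¹'
      {frestrictLe (π := fun _ : ℕ => X) n ω} := by
  ext u
  simp [mem_prefixCyl, funext_iff]

variable {X : Type*} [MeasurableSpace X] [MeasurableSingletonClass X] [Finite X]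
  (P Q : Measure (ℕ → X))

/-- The divergence of the laws of the first `n` terms. -/
def prefixDiv (n : ℕ) : ℝ :=
  ∫ ω, Real.log (P.real (prefixCyl n ω) / Q.real (prefixCyl n ω)) ∂P

theorem integrable_log_div_prefixCyl [IsFiniteMeasure P] (n : ℕ) :
    Integrable (fun ω => Real.log (P.real (prefixCyl n ω) / Q.real (prefixCyl n ω))) P :=
  integrable_of_prefix P n fun _ _ h => by rw [prefixCyl_congr h]

/-- Restriction to times 0, ..., n keeps n + 1 terms, whence the shift of index. The prefixes live
in a finite space, where positivity of atoms is absolute continuity, the log-likelihood ratio is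
integrable, and the density on an atom is the quotient of masses. -/
theorem klDiv_map_frestrictLe [IsProbabilityMeasure P] [IsProbabilityMeasure Q] (n : ℕ)
    (h : ∀ ω, P.real (prefixCyl (n + 1) ω) ≠ 0 → Q.real (prefixCyl (n + 1) ω) ≠ 0) :
    klDiv (P.map (frestrictLe (π := fun _ : ℕ => X) n))
      (Q.map (frestrictLe (π := fun _ : ℕ => X) n)) = ENNReal.ofReal (prefixDiv P Q (n + 1)) := by
  have hr : Measurable (frestrictLe (π := fun _ : ℕ => X) n) := measurable_frestrictLe n
  set P' := P.map (frestrictLe (π := fun _ : ℕ => X) n) with hP'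
  set Q' := Q.map (frestrictLe (π := fun _ : ℕ => X) n) with hQ'
  have : IsProbabilityMeasure P' := Measure.isProbabilityMeasure_map hr.aemeasurable
  have : IsProbabilityMeasure Q' := Measure.isProbabilityMeasure_map hr.aemeasurable
  have hPs : ∀ ω, P'.real {frestrictLe (π := fun _ : ℕ => X) n ω} =
      P.real (prefixCyl (n + 1) ω) := fun ω => by
    rw [hP', map_measureReal_apply hr (measurableSet_singleton _), prefixCyl_succ_eq_preimage]
  have hQs : ∀ ω, Q'.real {frestrictLe (π := fun _ : ℕ => X) n ω} =
      Q.real (prefixCyl (n + 1) ω) := fun ω => by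
    rw [hQ', map_measureReal_apply hr (measurableSet_singleton _), prefixCyl_succ_eq_preimage]
  have hac : P' ≪ Q' := by
    intro s hs
    rw [measure_null_iff_singleton (Set.to_countable s)] at hs ⊢
    intro x hx
    by_contra hne
    have hne' : (frestrictLe (π := fun _ : ℕ => X) n ⁻¹' {x}).Nonempty := by
      by_contra hem
      rw [Set.not_nonempty_iff_eq_empty] at hem
      rw [hP', Measure.map_apply hr (measurableSet_singleton _), hem, measure_empty] at hne
      exact hne rfl
    obtain ⟨ω, rfl⟩ := hne'
    refine h ω ?_ ?_
    · rw [← hPs, measureReal_def, ENNReal.toReal_ne_zero]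
      exact ⟨hne, measure_ne_top _ _⟩
    · rw [← hQs, measureReal_def, hs _ hx, ENNReal.toReal_zero]
  rw [← ENNReal.ofReal_toReal (klDiv_ne_top hac Integrable.of_finite),
    toReal_klDiv_of_measure_eq hac (by simp)]
  congr 1
  rw [hP', integral_map hr.aemeasurable (Integrable.of_finite (μ := P')).1]
  refine integral_congr_ae ?_
  filter_upwards [ae_prefixCyl_ne_zero P] with ω hω
  have h0 := h ω (hω (n + 1))
  have hd : P' {frestrictLe (π := fun _ : ℕ => X) n ω} =
      P'.rnDeriv Q' (frestrictLe (π := fun _ : ℕ => X) n ω) *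
        Q' {frestrictLe (π := fun _ : ℕ => X) n ω} := by
    conv_lhs => rw [← Measure.withDensity_rnDeriv_eq P' Q' hac]
    rw [withDensity_apply _ (measurableSet_singleton _), lintegral_singleton]
  have hd' := congrArg ENNReal.toReal hd
  rw [ENNReal.toReal_mul] at hd'
  change P'.real _ = _ * Q'.real _ at hd'
  rw [hPs, hQs] at hd'
  rw [llr, hd', mul_div_cancel_right₀ _ h0]

end PrefixDivergence

/-! ### Chain rule for laws built from the team's predictions. -/

section TeamPrediction

variable {ι X : Type*} [Fintype ι] {Y : ι → Type*} (loc : ∀ i, X → Y i)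
  [MeasurableSpace X] (P : Measure (ℕ → X))

/-- `Q` extends the prefixes of the sequences that are possible under `P` by the predictions made
under intermittent communication. -/
def IsTeamLaw (lam : ℕ → Bool) (Q : Measure (ℕ → X)) : Prop :=
  ∀ n ω, P.real (prefixCyl (n + 1) ω) ≠ 0 →
    Q.real (prefixCyl (n + 1) ω) = Q.real (prefixCyl n ω) * teamPred loc P lam n ω

/-- The loss in predicting the term at time `n` when the agents never communicate. -/
def predLoss (n : ℕ) : ℝ :=
  ∫ ω, (Real.log (jointPred P n ω) - Real.log (∏ i, localPred loc P (fun _ => false) i n ω)) ∂P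

variable {loc P}

/-- All predictions made along a prefix possible under P are positive, since each conditioning event
contains that prefix. This supplies absolute continuity of prefix laws. -/
theorem IsTeamLaw.pos {lam : ℕ → Bool} {Q : Measure (ℕ → X)} [IsFiniteMeasure P]
    [IsProbabilityMeasure Q] (hQ : IsTeamLaw loc P lam Q) {n : ℕ} {ω : ℕ → X}
    (h : P.real (prefixCyl n ω) ≠ 0) : 0 < Q.real (prefixCyl n ω) := by
  induction n with
  | zero => simp [prefixCyl_zero]
  | succ n ih =>
    rw [hQ n ω h]
    refine mul_pos (ih fun h0 => h ?_) (teamPred_pos loc lam h)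
    exact measureReal_mono_null (prefixCyl_anti n.le_succ ω) h0

variable [MeasurableSingletonClass X] [Fintype X] [IsProbabilityMeasure P]

/-- One more term multiplies the prefix mass under P by `jointPred` and that under Q by `teamPred`,
so the logarithm of the quotient telescopes. -/
theorem IsTeamLaw.prefixDiv_eq {lam : ℕ → Bool} {Q : Measure (ℕ → X)}
    [IsProbabilityMeasure Q] (hQ : IsTeamLaw loc P lam Q) (n : ℕ) :
    prefixDiv P Q n = ∑ k ∈ Finset.range n,
      ∫ ω, (Real.log (jointPred P k ω) - Real.log (teamPred loc P lam k ω)) ∂P := by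
  induction n with
  | zero => simp [prefixDiv, prefixCyl_zero]
  | succ n ih =>
    have hd : Integrable (fun ω => Real.log (jointPred P n ω) -
        Real.log (teamPred loc P lam n ω)) P :=
      (integrable_log_jointPred P n).sub (integrable_log_teamPred loc P lam n)
    rw [Finset.sum_range_succ, ← ih, prefixDiv, prefixDiv, ← integral_add
      (integrable_log_div_prefixCyl P Q n) hd]
    refine integral_congr_ae ?_
    filter_upwards [ae_prefixCyl_ne_zero P] with ω hω
    have hq := (hQ.pos (hω n)).ne'
    have ht := (teamPred_pos loc lam (hω (n + 1))).ne'
    have hp := hω n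
    have hp' := hω (n + 1)
    rw [hQ n ω hp', jointPred, Real.log_div hp' (mul_ne_zero hq ht), Real.log_mul hq ht,
      Real.log_div hp hq, Real.log_div hp' hp]
    ring

theorem IsTeamLaw.prefixDiv_false {Q : Measure (ℕ → X)} [IsProbabilityMeasure Q]
    (hQ : IsTeamLaw loc P (fun _ => false) Q) (n : ℕ) :
    prefixDiv P Q n = ∑ k ∈ Finset.range n, predLoss loc P k := by
  rw [hQ.prefixDiv_eq]
  simp [teamPred, predLoss]

variable [∀ i, Fintype (Y i)]

theorem predLoss_nonneg [DecidableEq ι] (hloc : ∀ x x', (∀ i, loc i x = loc i x') → x = x')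
    (n : ℕ) : 0 ≤ predLoss loc P n := by
  have h := integrable_log_teamPred loc P (fun _ => false) n
  simp only [teamPred, Bool.false_eq_true, if_false] at h
  rw [predLoss, integral_sub (integrable_log_jointPred P n) h]
  exact sub_nonneg.2 (integral_log_prod_localPred_false_le loc P hloc n)

/-- With communication the two predictions coincide. Without it, the logarithm of the product splits
almost surely into a sum over agents, and the comparison of more with less knowledge is made agent
by agent. -/
theorem integral_log_teamPred_le (lam : ℕ → Bool) (n : ℕ) :
    ∫ ω, (Real.log (jointPred P n ω) - Real.log (teamPred loc P lam n ω)) ∂P ≤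
      if lam n then 0 else predLoss loc P n := by
  cases hlam : lam n with
  | true => simp [teamPred, hlam]
  | false =>
    have hlog : ∀ lam' : ℕ → Bool, ∀ᵐ ω ∂P, Real.log (∏ i, localPred loc P lam' i n ω) =
        ∑ i, Real.log (localPred loc P lam' i n ω) := fun lam' => by
      filter_upwards [ae_prefixCyl_ne_zero P] with ω hω
      exact Real.log_prod fun i _ => (localPred_pos loc lam' i (hω (n + 1))).ne'
    have hint : ∀ lam' : ℕ → Bool,
        Integrable (fun ω => ∑ i, Real.log (localPred loc P lam' i n ω)) P := fun lam' =>
      integrable_finsetSum _ fun i _ => integrable_log_localPred loc P lam' i n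
    have hsplit : ∀ lam' : ℕ → Bool, ∫ ω, (Real.log (jointPred P n ω) -
        Real.log (∏ i, localPred loc P lam' i n ω)) ∂P = ∫ ω, Real.log (jointPred P n ω) ∂P -
          ∑ i, ∫ ω, Real.log (localPred loc P lam' i n ω) ∂P := fun lam' => by
      rw [← integral_finsetSum _ fun i _ => integrable_log_localPred loc P lam' i n,
        ← integral_sub (integrable_log_jointPred P n) (hint lam')]
      refine integral_congr_ae ?_
      filter_upwards [hlog lam'] with ω hω
      rw [hω]
    simp only [teamPred, hlam, Bool.false_eq_true, if_false, predLoss]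
    rw [hsplit, hsplit]
    exact sub_le_sub_left (Finset.sum_le_sum fun i _ =>
      integral_log_localPred_false_le loc P lam i n) _

theorem IsTeamLaw.prefixDiv_le {lam : ℕ → Bool} {Q : Measure (ℕ → X)}
    [IsProbabilityMeasure Q] (hQ : IsTeamLaw loc P lam Q) (n : ℕ) :
    prefixDiv P Q n ≤ ∑ k ∈ Finset.range n, if lam k then 0 else predLoss loc P k := by
  rw [hQ.prefixDiv_eq]
  exact Finset.sum_le_sum fun k _ => integral_log_teamPred_le lam k

end TeamPrediction

/-! ### Averaging the second argument of the divergence. -/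

section Mixture

variable {X : Type*} [MeasurableSpace X] {Θ : Type*} [MeasurableSpace Θ] {μ : Measure Θ}
  {Q : Θ → Measure (ℕ → X)} [∀ θ, IsProbabilityMeasure (Q θ)]

theorem measureReal_bind (hQ : Measurable Q) {s : Set (ℕ → X)} (hs : MeasurableSet s) :
    (μ.bind Q).real s = ∫ θ, (Q θ).real s ∂μ := by
  rw [measureReal_def, Measure.bind_apply hs hQ.aemeasurable]
  exact (integral_toReal ((Measure.measurable_coe hs).comp hQ).aemeasurable
    (ae_of_all _ fun θ => measure_lt_top _ _)).symm

variable [IsProbabilityMeasure μ]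

theorem integrable_measureReal (hQ : Measurable Q) {s : Set (ℕ → X)} (hs : MeasurableSet s) :
    Integrable (fun θ => (Q θ).real s) μ :=
  Integrable.of_bound (((Measure.measurable_coe hs).comp hQ).ennreal_toReal.aestronglyMeasurable) 1
    (ae_of_all _ fun θ => by
      rw [Real.norm_of_nonneg measureReal_nonneg]
      exact measureReal_le_one)

theorem measureReal_bind_pos (hQ : Measurable Q) {s : Set (ℕ → X)} (hs : MeasurableSet s)
    (h : ∀ θ, 0 < (Q θ).real s) : 0 < (μ.bind Q).real s := by
  rw [measureReal_bind hQ hs, integral_pos_iff_support_of_nonneg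
    (fun θ => measureReal_nonneg) (integrable_measureReal hQ hs)]
  have : (Function.support fun θ => (Q θ).real s) = Set.univ :=
    Set.eq_univ_of_forall fun θ => (h θ).ne'
  rw [this, measure_univ]
  exact one_pos

variable [MeasurableSingletonClass X] [Fintype X] {P : Measure (ℕ → X)} [IsProbabilityMeasure P]

/-- Convexity of the divergence of prefixes in the second argument. -/
theorem prefixDiv_bind_le (hQ : Measurable Q) {n : ℕ}
    (hpos : ∀ θ ω, P.real (prefixCyl n ω) ≠ 0 → 0 < (Q θ).real (prefixCyl n ω))
    {L : Θ → ℝ} (hL : Integrable L μ) (h : ∀ θ, prefixDiv P (Q θ) n ≤ L θ) :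
    prefixDiv P (μ.bind Q) n ≤ ∫ θ, L θ ∂μ := by
  set r : (ℕ → X) → Fin n → X := fun u k => u k with hr
  have hrm : ∀ v, MeasurableSet (r ⁻¹' {v}) := fun v =>
    measurable_pi_lambda _ (fun k => measurable_pi_apply _) (measurableSet_singleton v)
  have hposb : ∀ ω, P.real (prefixCyl n ω) ≠ 0 → 0 < (μ.bind Q).real (prefixCyl n ω) := fun ω hω =>
    measureReal_bind_pos hQ (measurableSet_prefixCyl n ω) fun θ => hpos θ ω hω
  have hsum : ∀ θ, Integrable (fun ω => (Q θ).real (prefixCyl n ω) /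
        (μ.bind Q).real (prefixCyl n ω)) P ∧
      ∫ ω, (Q θ).real (prefixCyl n ω) / (μ.bind Q).real (prefixCyl n ω) ∂P =
        ∑ v, P.real (r ⁻¹' {v}) * ((Q θ).real (r ⁻¹' {v}) / (μ.bind Q).real (r ⁻¹' {v})) :=
    fun θ => by
      simp only [prefixCyl_eq_preimage]
      exact integral_comp_fintype hrm fun v =>
        (Q θ).real (r ⁻¹' {v}) / (μ.bind Q).real (r ⁻¹' {v})
  -- Write R for the mixture. From log t ≤ t - 1 at t = Qθ / R follows log (P / R) ≤ log (P / Qθ) +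
  -- Qθ / R - 1 on each prefix. Averaged over θ, the correction Qθ / R - 1 contributes at most 0.
  have hθ : ∀ θ, prefixDiv P (μ.bind Q) n ≤ L θ +
      (∑ v, P.real (r ⁻¹' {v}) * ((Q θ).real (r ⁻¹' {v}) / (μ.bind Q).real (r ⁻¹' {v})) - 1) := by
    intro θ
    refine le_trans ?_ (add_le_add_left (h θ) _)
    rw [← (hsum θ).2, prefixDiv, prefixDiv, add_sub_assoc', ← integral_add
      (integrable_log_div_prefixCyl P (Q θ) n) (hsum θ).1, le_sub_iff_add_le]
    have h1 : ∫ _ : ℕ → X, (1 : ℝ) ∂P = 1 := by simp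
    conv_lhs => rw [← h1]
    rw [← integral_add (integrable_log_div_prefixCyl P _ n) (integrable_const _)]
    refine integral_mono_ae ((integrable_log_div_prefixCyl P _ n).add (integrable_const _))
      ((integrable_log_div_prefixCyl P (Q θ) n).add (hsum θ).1) ?_
    filter_upwards [ae_prefixCyl_ne_zero P] with ω hω
    have hp := hω n
    have ha := hpos θ ω hp
    have hb := hposb ω hp
    have hlog := Real.log_le_sub_one_of_pos (div_pos ha hb)
    rw [Real.log_div ha.ne' hb.ne'] at hlog
    rw [Real.log_div hp ha.ne', Real.log_div hp hb.ne']
    linarith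
  have hint : ∀ v, Integrable (fun θ => P.real (r ⁻¹' {v}) *
      ((Q θ).real (r ⁻¹' {v}) / (μ.bind Q).real (r ⁻¹' {v}))) μ := fun v =>
    ((integrable_measureReal hQ (hrm v)).div_const _).const_mul _
  have hints := integrable_finsetSum Finset.univ fun v _ => hint v
  have hconst : prefixDiv P (μ.bind Q) n = ∫ _ : Θ, prefixDiv P (μ.bind Q) n ∂μ := by simp
  rw [hconst]
  refine (integral_mono (integrable_const _) (hL.add (hints.sub (integrable_const 1))) hθ).trans ?_
  rw [integral_add' hL (hints.sub (integrable_const 1)),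
    integral_sub' hints (integrable_const 1), integral_finsetSum _ fun v _ => hint v]
  have hle : ∑ v, ∫ θ, P.real (r ⁻¹' {v}) *
      ((Q θ).real (r ⁻¹' {v}) / (μ.bind Q).real (r ⁻¹' {v})) ∂μ ≤ 1 := by
    rw [← sum_measureReal_fiber (P := P) hrm]
    refine Finset.sum_le_sum fun v _ => ?_
    rw [integral_const_mul, integral_div, ← measureReal_bind hQ (hrm v)]
    -- On a word that is null under the mixture the quotient is 0/0 = 0, hence an inequality and not
    -- an equality.
    exact mul_le_of_le_one_right measureReal_nonneg (div_self_le_one _)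
  have h1 : ∫ _ : Θ, (1 : ℝ) ∂μ = 1 := by simp
  rw [h1]
  linarith

theorem integral_sum_ite_eq {lam : ℕ → Θ → Bool} (hlam : ∀ t, Measurable (lam t)) {q : ℝ}
    (hq1 : q ≤ 1) (hμ : ∀ t, μ {θ | lam t θ = true} = ENNReal.ofReal (1 - q)) (c : ℕ → ℝ)
    (n : ℕ) :
    Integrable (fun θ => ∑ k ∈ Finset.range n, if lam k θ then 0 else c k) μ ∧
      ∫ θ, (∑ k ∈ Finset.range n, if lam k θ then 0 else c k) ∂μ =
        q * ∑ k ∈ Finset.range n, c k := by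
  have hms : ∀ k, MeasurableSet {θ | lam k θ = true} := fun k =>
    hlam k (measurableSet_singleton true)
  have hind : ∀ k, (fun θ => if lam k θ then 0 else c k) =
      {θ | lam k θ = true}ᶜ.indicator fun _ => c k := fun k => by
    funext θ
    by_cases h : lam k θ <;> simp [h]
  have hint : ∀ k, Integrable (fun θ => if lam k θ then 0 else c k) μ := fun k => by
    rw [hind]
    exact (integrable_const _).indicator (hms k).compl
  refine ⟨integrable_finsetSum _ fun k _ => hint k, ?_⟩
  rw [integral_finsetSum _ fun k _ => hint k, Finset.mul_sum]
  refine Finset.sum_congr rfl fun k _ => ?_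
  rw [hind, integral_indicator_const _ (hms k).compl, probReal_compl_eq_one_sub (hms k),
    measureReal_def, hμ, ENNReal.toReal_ofReal (by linarith), smul_eq_mul]
  ring

end Mixture

/-! ### Initial law and Markov property of a chain on single states. -/

section ChainLaw

open Preorder

variable {X : Type*} [MeasurableSpace X] [MeasurableSingletonClass X]

theorem measurableSet_eval_eq (n : ℕ) (x : X) : MeasurableSet {ω : ℕ → X | ω n = x} :=
  (measurable_pi_apply n : Measurable fun ω : ℕ → X => ω n) (measurableSet_singleton x)

variable [Countable X] (init : PMF X) (step : ℕ → X → PMF X)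

theorem chainLaw_real_eval_zero (x : X) :
    (chainLaw init step).real {ω | ω 0 = x} = (init x).toReal := by
  have : IsProbabilityMeasure init.toMeasure := PMF.toMeasure.isProbabilityMeasure init
  have hU : MeasurableSet {h : (i : Finset.Iic 0) → (fun _ : ℕ => X) i |
      h ⟨0, Finset.mem_Iic.2 le_rfl⟩ = x} :=
    (measurable_pi_apply _ : Measurable fun h : (i : Finset.Iic 0) → (fun _ : ℕ => X) i =>
      h ⟨0, Finset.mem_Iic.2 le_rfl⟩) (measurableSet_singleton x)
  have h1 : chainLaw init step {ω | ω 0 = x} =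
      (chainLaw init step).map (frestrictLe (π := fun _ : ℕ => X) 0)
        {h | h ⟨0, Finset.mem_Iic.2 le_rfl⟩ = x} := by
    rw [Measure.map_apply (measurable_frestrictLe 0) hU]
    rfl
  rw [measureReal_def, h1]
  unfold chainLaw Kernel.trajMeasure
  rw [Measure.map_comp _ _ (by fun_prop), Kernel.traj_map_frestrictLe, Kernel.partialTraj_self,
    Measure.id_comp, Measure.map_apply (by fun_prop) hU,
    ← PMF.toMeasure_apply_singleton init x (measurableSet_singleton x)]
  rfl

/-- The Markov property. -/
theorem chainLaw_real_inter_eval {n : ℕ} {B : Set (ℕ → X)}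
    (hB : ∀ ω ω', (∀ k < n + 1, ω k = ω' k) → ω ∈ B → ω' ∈ B) (x y : X) :
    (chainLaw init step).real (B ∩ {ω | ω n = x} ∩ {ω | ω (n + 1) = y}) =
      (chainLaw init step).real (B ∩ {ω | ω n = x}) * (step n x y).toReal := by
  have : IsProbabilityMeasure init.toMeasure := PMF.toMeasure.isProbabilityMeasure init
  have hr := measurable_frestrictLe (X := fun _ : ℕ => X) n
  set T := frestrictLe (π := fun _ : ℕ => X) n '' (B ∩ {ω | ω n = x}) with hT
  have hTm : MeasurableSet T := (Set.to_countable T).measurableSet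
  have hpre : B ∩ {ω | ω n = x} = frestrictLe (π := fun _ : ℕ => X) n ⁻¹' T := by
    refine (Set.subset_preimage_image _ _).antisymm ?_
    rintro ω ⟨u, ⟨hu, hux⟩, huω⟩
    have hk : ∀ k < n + 1, u k = ω k := fun k hk =>
      congrFun huω ⟨k, Finset.mem_Iic.2 (Nat.lt_succ_iff.1 hk)⟩
    exact ⟨hB u ω hk hu, (hk n n.lt_succ_self).symm.trans hux⟩
  have hmap := Kernel.map_frestrictLe_trajMeasure_compProd_eq_map_trajMeasure
    (X := fun _ : ℕ => X) (μ₀ := init.toMeasure) (κ := stepKernel step) (a := n)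
  have h1 := congrArg (fun ν => ν (T ×ˢ {y})) hmap
  rw [Measure.compProd_apply_prod hTm (measurableSet_singleton y),
    Measure.map_apply (by fun_prop) (hTm.prod (measurableSet_singleton y))] at h1
  have h2 : (fun ω : ℕ → X => (frestrictLe (π := fun _ : ℕ => X) n ω, ω (n + 1))) ⁻¹'
      (T ×ˢ {y}) = B ∩ {ω | ω n = x} ∩ {ω | ω (n + 1) = y} := by
    rw [hpre]
    rfl
  -- All prefixes in `T` end in x, so the transition probability is constant there and comes out of
  -- the integral.
  have h3 : ∀ h ∈ T, stepKernel step n h {y} = step n x y := by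
    rintro _ ⟨u, ⟨_, hu⟩, rfl⟩
    rw [← PMF.toMeasure_apply_singleton (step n x) y (measurableSet_singleton y), ← hu]
    rfl
  rw [setLIntegral_congr_fun hTm h3, setLIntegral_const, Measure.map_apply hr hTm, ← hpre, h2] at h1
  rw [measureReal_def, measureReal_def, mul_comm, ← ENNReal.toReal_mul]
  exact congrArg ENNReal.toReal h1.symm

variable {X : Type*} [Fintype X] [MeasurableSpace X] [MeasurableSingletonClass X]

theorem measureReal_eq_sum_eval (μ : Measure (ℕ → X)) [IsFiniteMeasure μ] (n : ℕ)
    {B : Set (ℕ → X)} (hB : MeasurableSet B) :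
    μ.real B = ∑ x, μ.real (B ∩ {ω | ω n = x}) := by
  rw [← measureReal_biUnion_finset]
  · congr 1
    ext ω
    simp
  · intro x _ x' _ hxx'
    refine Set.disjoint_left.2 ?_
    rintro u ⟨_, hu⟩ ⟨_, hu'⟩
    exact hxx' (hu.symm.trans hu')
  · exact fun x _ => hB.inter (measurableSet_eval_eq n x)

theorem chainLaw_real_inter_succ (init : PMF X) (step : ℕ → X → PMF X) {n : ℕ} {B : Set (ℕ → X)}
    (hB : ∀ ω ω', (∀ k < n + 1, ω k = ω' k) → ω ∈ B → ω' ∈ B) (y : X) :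
    (chainLaw init step).real (B ∩ {ω | ω (n + 1) = y}) =
      ∑ x, (chainLaw init step).real (B ∩ {ω | ω n = x}) * (step n x y).toReal := by
  rw [measureReal_eq_sum_eval _ n
    ((measurableSet_of_prefix (n + 1) hB).inter (measurableSet_eval_eq (n + 1) y))]
  refine Finset.sum_congr rfl fun x _ => ?_
  rw [← chainLaw_real_inter_eval init step hB, Set.inter_right_comm]

end ChainLaw

section PMF

/-- Used with f spreading one joint configuration to all agents and g = `actual`, which describes a
round with communication. -/
theorem toReal_map_apply_of_leftInverse {α β : Type*} (p : PMF α) {f : α → β} {g : β → α}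
    (hg : Function.LeftInverse g f) (b : β) :
    (p.map f b).toReal = open Classical in if b = f (g b) then (p (g b)).toReal else 0 := by
  classical
  rw [PMF.map_apply]
  split_ifs with h
  · rw [tsum_eq_single (g b)]
    · rw [if_pos h]
    · intro a ha
      refine if_neg fun hb => ha ?_
      rw [hb, hg]
  · rw [← ENNReal.toReal_zero]
    congr 1
    rw [ENNReal.tsum_eq_zero]
    intro a
    refine if_neg fun hb => h ?_
    rw [hb, hg]

end PMF

/-! ### The execution law follows the team's predictions. -/

section TeamLaw

variable {ι : Type*} {S A : ι → Type*}

/-- The state and the action of agent `i`. -/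
def ownPart (i : ι) (x : Joint S A) : S i × A i := (x.1 i, x.2 i)

theorem ext_ownPart {x x' : Joint S A} (h : ∀ i, ownPart i x = ownPart i x') : x = x' :=
  Prod.ext (funext fun i => congrArg Prod.fst (h i)) (funext fun i => congrArg Prod.snd (h i))

theorem actual_eq_iff {c : Config S A} {x : Joint S A} :
    actual c = x ↔ ∀ i, ownPart i (c i) = ownPart i x :=
  ⟨fun h _ => h ▸ rfl, fun h => ext_ownPart h⟩

theorem leftInverse_actual :
    Function.LeftInverse (actual : Config S A → Joint S A) fun x _ => x := fun _ => rfl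

/-- The configurations for which the path up to time `n` is that of `ω`. -/
def execCyl (n : ℕ) (ω : ℕ → Joint S A) : Set (ℕ → Config S A) :=
  {γ | ∀ k < n, actual (γ k) = ω k}

theorem execCyl_zero (ω : ℕ → Joint S A) : execCyl 0 ω = Set.univ :=
  Set.eq_univ_of_forall fun _ k hk => absurd hk (Nat.not_lt_zero k)

theorem execCyl_prefix (n : ℕ) (ω : ℕ → Joint S A) (γ γ' : ℕ → Config S A)
    (h : ∀ k < n, γ k = γ' k) (hγ : γ ∈ execCyl n ω) : γ' ∈ execCyl n ω :=
  fun k hk => by rw [← h k hk]; exact hγ k hk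

theorem execCyl_succ_inter_of_eq {n : ℕ} {ω : ℕ → Joint S A} {c : Config S A}
    (h : actual c = ω n) :
    execCyl (n + 1) ω ∩ {γ | γ n = c} = execCyl n ω ∩ {γ | γ n = c} := by
  ext γ
  refine and_congr_left fun (hγ : γ n = c) => ⟨fun h' k hk => h' k (by omega), fun h' k hk => ?_⟩
  rcases Nat.lt_succ_iff_lt_or_eq.1 hk with hk | rfl
  · exact h' k hk
  · rw [hγ, h]

theorem execCyl_succ_inter_of_ne {n : ℕ} {ω : ℕ → Joint S A} {c : Config S A}
    (h : actual c ≠ ω n) : execCyl (n + 1) ω ∩ {γ | γ n = c} = ∅ := by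
  refine Set.eq_empty_of_forall_notMem ?_
  rintro γ ⟨hγ, hc⟩
  refine h ?_
  rw [← show γ n = c from hc]
  exact hγ n n.lt_succ_self

variable [Fintype ι] [∀ i, Fintype (S i)] [∀ i, Fintype (A i)]
  [∀ i, MeasurableSpace (S i)] [∀ i, MeasurableSingletonClass (S i)]
  [∀ i, MeasurableSpace (A i)] [∀ i, MeasurableSingletonClass (A i)]

theorem measurable_actual_path :
    Measurable fun (γ : ℕ → Config S A) (t : ℕ) => actual (γ t) :=
  measurable_pi_lambda _ fun t => (measurable_of_countable actual).comp (measurable_pi_apply t)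

theorem measurableSet_infoSetNext (lam : ℕ → Bool) (i : ι) (n : ℕ) (ω : ℕ → Joint S A) :
    MeasurableSet (infoSetNext ownPart lam i n ω) :=
  (measurableSet_infoSet ownPart lam i n ω).inter
    (measurableSet_loc_fiber ownPart i n (ownPart i (ω n)))

variable [DecidableEq ι] (M : ∀ i, MDP (S i) (A i)) (π : (∀ i, S i) → PMF (∀ i, A i))

instance : IsProbabilityMeasure (fullPathDist M π) := by
  unfold fullPathDist
  infer_instance

/-- The law of the configurations under intermittent communication. -/
def configLaw (lam : ℕ → Bool) : Measure (ℕ → Config S A) :=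
  chainLaw (roundZero M π (lam 0)) fun t => roundSucc M π (lam (t + 1))

instance (lam : ℕ → Bool) : IsProbabilityMeasure (configLaw M π lam) := by
  unfold configLaw
  infer_instance

instance (lam : ℕ → Bool) : IsProbabilityMeasure (executionDist M π lam) :=
  Measure.isProbabilityMeasure_map (μ := configLaw M π lam) measurable_actual_path.aemeasurable

theorem executionDist_real_prefixCyl (lam : ℕ → Bool) (n : ℕ) (ω : ℕ → Joint S A) :
    (executionDist M π lam).real (prefixCyl n ω) = (configLaw M π lam).real (execCyl n ω) :=
  map_measureReal_apply measurable_actual_path (measurableSet_prefixCyl n ω)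

/-- The law of the next configuration given the past path: after communication, all agents hold the
true configuration; otherwise, they hold independent samples of what they cannot exclude. -/
def configPred (lam : ℕ → Bool) (n : ℕ) (ω : ℕ → Joint S A) (c : Config S A) : ℝ :=
  open Classical in
  if lam n then
    if c = fun _ => actual c then
      (fullPathDist M π).real (prefixCyl n ω ∩ {u | u n = actual c}) /
        (fullPathDist M π).real (prefixCyl n ω)
    else 0
  else ∏ i, (fullPathDist M π).real (infoSet ownPart lam i n ω ∩ {u | u n = c i}) /
    (fullPathDist M π).real (infoSet ownPart lam i n ω)

variable {M π}

/-- The law of the present configuration, together with the event that the path continues as `ω`. -/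
theorem configLaw_real_execCyl_succ_inter {lam : ℕ → Bool} {n : ℕ} {ω : ℕ → Joint S A}
    (h : ∀ c, (configLaw M π lam).real (execCyl n ω ∩ {γ | γ n = c}) =
      (configLaw M π lam).real (execCyl n ω) * configPred M π lam n ω c) (c : Config S A) :
    (configLaw M π lam).real (execCyl (n + 1) ω ∩ {γ | γ n = c}) =
      (configLaw M π lam).real (execCyl n ω) *
        open Classical in
        if lam n then if c = fun _ => ω n then jointPred (fullPathDist M π) n ω else 0
        else ∏ i, (fullPathDist M π).real (infoSetNext ownPart lam i n ω ∩ {u | u n = c i}) /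
          (fullPathDist M π).real (infoSet ownPart lam i n ω) := by
  classical
  by_cases hc : actual c = ω n
  · rw [execCyl_succ_inter_of_eq hc, h c, configPred, hc, jointPred, prefixCyl_succ]
    congr 1
    split_ifs with h1 h2
    · rfl
    · rfl
    · refine Finset.prod_congr rfl fun i _ => ?_
      congr 2
      -- The extra condition in `infoSetNext` is automatic: the configuration `c i` already has the
      -- own part of agent i prescribed by `ω n`.
      ext u
      refine ⟨fun ⟨hu, hn⟩ => ⟨⟨hu, ?_⟩, hn⟩, fun ⟨hu, hn⟩ => ⟨hu.1, hn⟩⟩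
      change ownPart i (u n) = ownPart i (ω n)
      rw [show u n = c i from hn]
      exact actual_eq_iff.1 hc i
  · rw [execCyl_succ_inter_of_ne hc, measureReal_empty]
    symm
    refine mul_eq_zero_of_right _ ?_
    split_ifs with h1 h2
    · exact absurd (by rw [h2]; rfl) hc
    · rfl
    · obtain ⟨i, hi⟩ := not_forall.1 (mt actual_eq_iff.2 hc)
      refine Finset.prod_eq_zero (Finset.mem_univ i) ?_
      have : infoSetNext ownPart lam i n ω ∩ {u | u n = c i} = ∅ := by
        refine Set.eq_empty_of_forall_notMem ?_
        rintro u ⟨⟨_, hu⟩, hn⟩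
        refine hi ?_
        rw [← show u n = c i from hn]
        exact hu
      rw [this, measureReal_empty, zero_div]

/-- Summing out the present configuration: with communication a single configuration contributes,
and without it the sum of products factors into one sum per agent, each giving a `localPred`. -/
theorem configLaw_real_execCyl_succ {lam : ℕ → Bool} {n : ℕ} {ω : ℕ → Joint S A}
    (h : ∀ c, (configLaw M π lam).real (execCyl n ω ∩ {γ | γ n = c}) =
      (configLaw M π lam).real (execCyl n ω) * configPred M π lam n ω c) :
    (configLaw M π lam).real (execCyl (n + 1) ω) =
      (configLaw M π lam).real (execCyl n ω) * teamPred ownPart (fullPathDist M π) lam n ω := by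
  classical
  rw [measureReal_eq_sum_eval _ n (measurableSet_of_prefix (n + 1) (execCyl_prefix (n + 1) ω))]
  simp only [configLaw_real_execCyl_succ_inter h]
  rw [← Finset.mul_sum, teamPred]
  congr 1
  split_ifs with hlam
  · rw [Finset.sum_ite_eq' Finset.univ, if_pos (Finset.mem_univ _)]
  · rw [← Fintype.prod_sum fun i y =>
      (fullPathDist M π).real (infoSetNext ownPart lam i n ω ∩ {u | u n = y}) /
        (fullPathDist M π).real (infoSet ownPart lam i n ω)]
    refine Finset.prod_congr rfl fun i _ => ?_
    rw [← Finset.sum_div, ← measureReal_eq_sum_eval _ n (measurableSet_infoSetNext lam i n ω),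
      localPred]

/-- Given the path, the agents' configurations are independent, and distributed as what they cannot
exclude. -/
theorem configLaw_real_posterior {lam : ℕ → Bool} {n : ℕ} {ω : ℕ → Joint S A}
    (h : ∀ c, (configLaw M π lam).real (execCyl n ω ∩ {γ | γ n = c}) =
      (configLaw M π lam).real (execCyl n ω) * configPred M π lam n ω c)
    (hω : (fullPathDist M π).real (prefixCyl (n + 1) ω) ≠ 0) (c : Config S A) :
    (configLaw M π lam).real (execCyl (n + 1) ω ∩ {γ | γ n = c}) =
      (configLaw M π lam).real (execCyl (n + 1) ω) *
        ∏ i, (fullPathDist M π).real (infoSet ownPart lam i (n + 1) ω ∩ {u | u n = c i}) /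
          (fullPathDist M π).real (infoSet ownPart lam i (n + 1) ω) := by
  classical
  rw [configLaw_real_execCyl_succ_inter h, configLaw_real_execCyl_succ h, mul_assoc, teamPred]
  congr 1
  cases hlam : lam n with
  | true =>
    -- Both sides are now point masses at the configuration in which every agent holds `ω n`.
    simp only [if_true, infoSet_succ_of_true ownPart _ hlam]
    split_ifs with hc
    · have : ∀ i, prefixCyl (n + 1) ω ∩ {u | u n = c i} = prefixCyl (n + 1) ω := fun i => by
        refine Set.inter_eq_left.2 fun u hu => ?_
        change u n = c i
        rw [hc]
        exact hu n n.lt_succ_self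
      simp only [this, div_self hω, Finset.prod_const_one, mul_one]
    · obtain ⟨i, hi⟩ := Function.ne_iff.1 hc
      have : prefixCyl (n + 1) ω ∩ {u | u n = c i} = ∅ := by
        refine Set.eq_empty_of_forall_notMem ?_
        rintro u ⟨hu, hn⟩
        refine hi ?_
        rw [← show u n = c i from hn]
        exact hu n n.lt_succ_self
      symm
      refine mul_eq_zero_of_right _ (Finset.prod_eq_zero (Finset.mem_univ i) ?_)
      rw [this, measureReal_empty, zero_div]
  | false =>
    simp only [Bool.false_eq_true, if_false]
    -- Bayes' rule for each agent separately: observing the own part turns the old knowledge into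
    -- the new one, whose probability is positive by `hω` and cancels.
    rw [← Finset.prod_mul_distrib]
    refine Finset.prod_congr rfl fun i _ => ?_
    have h0 := (measureReal_infoSet_pos ownPart lam i hω).ne'
    rw [localPred, ← infoSet_succ_of_false ownPart i hlam]
    field_simp

theorem configLaw_real_zero (lam : ℕ → Bool) (ω : ℕ → Joint S A) (c : Config S A) :
    (configLaw M π lam).real (execCyl 0 ω ∩ {γ | γ 0 = c}) =
      (configLaw M π lam).real (execCyl 0 ω) * configPred M π lam 0 ω c := by
  classical
  have hfull : ∀ x, (fullPathDist M π).real {u | u 0 = x} = (act π (jointInit M) x).toReal :=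
    chainLaw_real_eval_zero _ _
  simp only [execCyl_zero, Set.univ_inter, probReal_univ, one_mul, configPred, prefixCyl_zero,
    infoSet_zero, div_one, hfull]
  rw [configLaw, chainLaw_real_eval_zero]
  cases lam 0 with
  | true =>
    simp only [if_true]
    refine (toReal_map_apply_of_leftInverse (act π (jointInit M)) leftInverse_actual c).trans ?_
    congr
  | false =>
    simp only [Bool.false_eq_true, if_false]
    rw [← ENNReal.toReal_prod]
    rfl

/-- Every agent simulates its configuration with the transition of the full chain. Without
communication, independent configurations stay independent, and the Markov property of P, applied to
the event of each agent's knowledge, identifies their new laws. With communication only the true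
configuration matters. -/
theorem configLaw_real_succ {lam : ℕ → Bool} {n : ℕ} {ω : ℕ → Joint S A}
    (hω : (fullPathDist M π).real (prefixCyl (n + 1) ω) ≠ 0)
    (h : ∀ c, (configLaw M π lam).real (execCyl (n + 1) ω ∩ {γ | γ n = c}) =
      (configLaw M π lam).real (execCyl (n + 1) ω) *
        ∏ i, (fullPathDist M π).real (infoSet ownPart lam i (n + 1) ω ∩ {u | u n = c i}) /
          (fullPathDist M π).real (infoSet ownPart lam i (n + 1) ω)) (c : Config S A) :
    (configLaw M π lam).real (execCyl (n + 1) ω ∩ {γ | γ (n + 1) = c}) =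
      (configLaw M π lam).real (execCyl (n + 1) ω) * configPred M π lam (n + 1) ω c := by
  classical
  have hsucc : (configLaw M π lam).real (execCyl (n + 1) ω ∩ {γ | γ (n + 1) = c}) =
      ∑ c', (configLaw M π lam).real (execCyl (n + 1) ω ∩ {γ | γ n = c'}) *
        (roundSucc M π (lam (n + 1)) c' c).toReal :=
    chainLaw_real_inter_succ _ _ (execCyl_prefix (n + 1) ω) c
  rw [hsucc, configPred]
  cases lam (n + 1) with
  | true =>
    -- On the event of the path the actual configuration at time n is `ω n`, so the transition can
    -- be taken from `ω n` for every c'.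
    have hterm : ∀ c', (configLaw M π lam).real (execCyl (n + 1) ω ∩ {γ | γ n = c'}) *
        (roundSucc M π true c' c).toReal =
        (configLaw M π lam).real (execCyl (n + 1) ω ∩ {γ | γ n = c'}) *
          (((moveAct M π (ω n)).map fun x => fun _ => x : PMF (Config S A)) c).toReal := by
      intro c'
      by_cases hc : actual c' = ω n
      · rw [← hc]
        rfl
      · rw [execCyl_succ_inter_of_ne hc, measureReal_empty, zero_mul, zero_mul]
    rw [Finset.sum_congr rfl fun c' _ => hterm c', ← Finset.sum_mul, ← measureReal_eq_sum_eval _ n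
      (measurableSet_of_prefix (n + 1) (execCyl_prefix (n + 1) ω)),
      toReal_map_apply_of_leftInverse _ leftInverse_actual]
    congr 1
    simp only [if_true]
    congr 1
    have hself : prefixCyl (n + 1) ω ∩ {u | u n = ω n} = prefixCyl (n + 1) ω :=
      Set.inter_eq_left.2 fun u hu => hu n n.lt_succ_self
    have hmarkov := chainLaw_real_inter_eval (act π (jointInit M)) (fun _ => moveAct M π)
      (n := n) (B := prefixCyl (n + 1) ω)
      (fun _ _ h hu k hk => (h k hk).symm.trans (hu k hk)) (ω n) (actual c)
    rw [hself] at hmarkov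
    rw [fullPathDist] at hω ⊢
    rw [hmarkov, mul_div_cancel_left₀ _ hω]
  | false =>
    simp only [h, Bool.false_eq_true, if_false]
    have hterm : ∀ c' : Config S A, (configLaw M π lam).real (execCyl (n + 1) ω) *
        (∏ i, (fullPathDist M π).real (infoSet ownPart lam i (n + 1) ω ∩ {u | u n = c' i}) /
          (fullPathDist M π).real (infoSet ownPart lam i (n + 1) ω)) *
        (roundSucc M π false c' c).toReal = (configLaw M π lam).real (execCyl (n + 1) ω) *
        ∏ i, ((fullPathDist M π).real (infoSet ownPart lam i (n + 1) ω ∩ {u | u n = c' i}) *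
          (moveAct M π (c' i) (c i)).toReal /
            (fullPathDist M π).real (infoSet ownPart lam i (n + 1) ω)) := by
      intro c'
      have : (roundSucc M π false c' c).toReal = ∏ i, (moveAct M π (c' i) (c i)).toReal := by
        rw [← ENNReal.toReal_prod]
        rfl
      rw [this, mul_assoc, ← Finset.prod_mul_distrib]
      congr 1
      exact Finset.prod_congr rfl fun i _ => div_mul_eq_mul_div _ _ _
    rw [Finset.sum_congr rfl fun c' _ => hterm c', ← Finset.mul_sum]
    congr 1
    rw [← Fintype.prod_sum fun i y =>
      (fullPathDist M π).real (infoSet ownPart lam i (n + 1) ω ∩ {u | u n = y}) *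
          (moveAct M π y (c i)).toReal /
            (fullPathDist M π).real (infoSet ownPart lam i (n + 1) ω)]
    refine Finset.prod_congr rfl fun i _ => ?_
    rw [← Finset.sum_div]
    congr 1
    exact (chainLaw_real_inter_succ (act π (jointInit M)) (fun _ => moveAct M π)
      (infoSet_prefix ownPart lam i (n + 1) ω) (c i)).symm

/-- Filtering by induction on time: condition the predicted configurations on the executed term
(`configLaw_real_posterior`), then propagate one step (`configLaw_real_succ`). -/
theorem configLaw_real_eq_configPred (lam : ℕ → Bool) (n : ℕ) (ω : ℕ → Joint S A)
    (hω : (fullPathDist M π).real (prefixCyl n ω) ≠ 0) (c : Config S A) :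
    (configLaw M π lam).real (execCyl n ω ∩ {γ | γ n = c}) =
      (configLaw M π lam).real (execCyl n ω) * configPred M π lam n ω c := by
  induction n generalizing c with
  | zero => exact configLaw_real_zero lam ω c
  | succ n ih =>
    exact configLaw_real_succ hω (configLaw_real_posterior (ih fun h0 => hω
      (measureReal_mono_null (prefixCyl_anti n.le_succ ω) h0)) hω) c

/-- Under intermittent communication, the path is extended by the joint prediction when
communication is available, and by the product of the agents' own predictions when not. -/
theorem isTeamLaw_executionDist (lam : ℕ → Bool) :
    IsTeamLaw ownPart (fullPathDist M π) lam (executionDist M π lam) := by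
  intro n ω hω
  rw [executionDist_real_prefixCyl, executionDist_real_prefixCyl]
  exact configLaw_real_execCyl_succ (configLaw_real_eq_configPred lam n ω fun h0 => hω
    (measureReal_mono_null (prefixCyl_anti n.le_succ ω) h0))

end TeamLaw

/-! ### The two bounds. -/

section Main

open InformationTheory

variable {ι : Type*} [Fintype ι] [DecidableEq ι] {S A : ι → Type*}
  [∀ i, Fintype (S i)] [∀ i, Fintype (A i)]
  [∀ i, MeasurableSpace (S i)] [∀ i, MeasurableSingletonClass (S i)]
  [∀ i, MeasurableSpace (A i)] [∀ i, MeasurableSingletonClass (A i)]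
  (M : ∀ i, MDP (S i) (A i)) (π : (∀ i, S i) → PMF (∀ i, A i))

instance (lam : ℕ → Bool) : IsProbabilityMeasure (intPathDist M π lam) := by
  unfold intPathDist
  infer_instance

theorem imgPathDist_zero : imgPathDist M π 0 = executionDist M π fun _ => false := by
  simp [imgPathDist]

/-- For imaginary play the chain rule is an equality, so the sum is a prefix divergence; restriction
to a prefix does not increase the divergence. -/
theorem ofReal_sum_predLoss_le (n : ℕ) :
    ENNReal.ofReal (∑ k ∈ Finset.range (n + 1), predLoss ownPart (fullPathDist M π) k) ≤
      klDiv (fullPathDist M π) (imgPathDist M π 0) := by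
  have hT := isTeamLaw_executionDist (M := M) (π := π) fun _ => false
  rw [imgPathDist_zero, ← hT.prefixDiv_false,
    ← klDiv_map_frestrictLe _ _ n fun ω hω => (hT.pos hω).ne']
  exact klDiv_map_le _ _ (Preorder.measurable_frestrictLe n)

theorem klDiv_intPathDist_le (lam : ℕ → Bool) :
    klDiv (fullPathDist M π) (intPathDist M π lam) ≤
      klDiv (fullPathDist M π) (imgPathDist M π 0) := by
  have hT : IsTeamLaw ownPart (fullPathDist M π) lam (intPathDist M π lam) :=
    isTeamLaw_executionDist lam
  refine klDiv_le_of_forall_prefix _ _ fun n => ?_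
  rw [klDiv_map_frestrictLe _ _ n fun ω hω => (hT.pos hω).ne']
  refine (ENNReal.ofReal_le_ofReal ((hT.prefixDiv_le (n + 1)).trans
    (Finset.sum_le_sum fun k _ => ?_))).trans (ofReal_sum_predLoss_le M π n)
  split_ifs
  · exact predLoss_nonneg (fun _ _ h => ext_ownPart h) k
  · exact le_rfl

theorem klDiv_avgIntPathDist_le {Ω : Type*} [MeasurableSpace Ω] (P : Measure Ω)
    [IsProbabilityMeasure P] {q : ℝ} (hq0 : 0 ≤ q) (hq1 : q ≤ 1) {lam : ℕ → Ω → Bool}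
    (hlam : ∀ t, Measurable (lam t))
    (hP : ∀ t, P {ω | lam t ω = true} = ENNReal.ofReal (1 - q)) :
    klDiv (fullPathDist M π) (avgIntPathDist P M π lam) ≤
      ENNReal.ofReal q * klDiv (fullPathDist M π) (imgPathDist M π 0) := by
  have hQ : Measurable fun ω => intPathDist M π fun t => lam t ω :=
    (measurable_executionDist M π).comp (measurable_pi_lambda _ hlam)
  have hT : ∀ ω, IsTeamLaw ownPart (fullPathDist M π) (fun t => lam t ω)
      (intPathDist M π fun t => lam t ω) := fun ω => isTeamLaw_executionDist _
  have hprob : IsProbabilityMeasure (avgIntPathDist P M π lam) := ⟨by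
    rw [avgIntPathDist, Measure.bind_apply MeasurableSet.univ hQ.aemeasurable]
    simp⟩
  refine klDiv_le_of_forall_prefix _ _ fun n => ?_
  have hpos : ∀ u, (fullPathDist M π).real (prefixCyl (n + 1) u) ≠ 0 →
      0 < (avgIntPathDist P M π lam).real (prefixCyl (n + 1) u) := fun u hu =>
    measureReal_bind_pos (μ := P) hQ (measurableSet_prefixCyl (n + 1) u) fun ω => (hT ω).pos hu
  -- The loss at time k counts only when communication fails, which has probability q, so the factor
  -- q appears by linearity of expectation.
  have hL := integral_sum_ite_eq hlam hq1 hP (predLoss ownPart (fullPathDist M π)) (n + 1)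
  have hle := prefixDiv_bind_le (P := fullPathDist M π) hQ (fun ω u hu => (hT ω).pos hu) hL.1
    fun ω => (hT ω).prefixDiv_le (n + 1)
  rw [hL.2] at hle
  rw [klDiv_map_frestrictLe _ _ n fun u hu => (hpos u hu).ne']
  refine (ENNReal.ofReal_le_ofReal hle).trans ?_
  rw [ENNReal.ofReal_mul hq0]
  gcongr
  exact ofReal_sum_predLoss_le M π n

end Main

end TeamComm

end

theorem mainTheorem6 {ι : Type*} [Fintype ι] [DecidableEq ι] {S A : ι → Type*}
    [∀ i, Fintype (S i)] [∀ i, Fintype (A i)]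
    [∀ i, MeasurableSpace (S i)] [∀ i, MeasurableSingletonClass (S i)]
    [∀ i, MeasurableSpace (A i)] [∀ i, MeasurableSingletonClass (A i)]
    (M : ∀ i, TeamComm.MDP (S i) (A i)) (π : (∀ i, S i) → PMF (∀ i, A i)) :
    (∀ lam : ℕ → Bool,
      InformationTheory.klDiv (TeamComm.fullPathDist M π) (TeamComm.intPathDist M π lam) ≤
        InformationTheory.klDiv (TeamComm.fullPathDist M π) (TeamComm.imgPathDist M π 0)) ∧
    (∀ {Ω : Type*} [MeasurableSpace Ω] (P : Measure Ω) [IsProbabilityMeasure P]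
      (q : ℝ) (_ : 0 ≤ q) (_ : q ≤ 1) (lam : ℕ → Ω → Bool) (_ : ∀ t, Measurable (lam t))
      (_ : iIndepFun lam P) (_ : ∀ t, P {ω | lam t ω = true} = ENNReal.ofReal (1 - q)),
      InformationTheory.klDiv (TeamComm.fullPathDist M π) (TeamComm.avgIntPathDist P M π lam) ≤
        ENNReal.ofReal q *
          InformationTheory.klDiv (TeamComm.fullPathDist M π)
            (TeamComm.imgPathDist M π 0)) :=
  ⟨TeamComm.klDiv_intPathDist_le M π, fun P _ _ hq0 hq1 _ hlam _ hP =>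
    TeamComm.klDiv_avgIntPathDist_le M π P hq0 hq1 hlam hP⟩
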